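/- Let $I=[-1,1]$, $\omega_\alpha(x)=(1-x^2)^\alpha$, and let $\langle f,g\rangle_{\omega_\alpha}=\int_{-1}^1 f\,\overline{g}\,\omega_\alpha\,dx$ be the inner product of the complex space $L^2(I,\omega_\alpha)$. For $c>0$, $\alpha>0$ let $\mathcal F_c^{(\alpha)}f(x)=\int_{-1}^1 e^{icxy}f(y)\,\omega_\alpha(y)\,dy$ on $L^2(I,\omega_\alpha)$. The generalized prolate spheroidal wave functions $(\psi_{n,c}^{(\alpha)})_{n\ge 0}$ are a maximal orthonormal system of eigenfunctions of $\mathcal F_c^{(\alpha)}$, arranged so that the moduli $|\mu_n|$ of the corresponding eigenvalues are non-increasing. Put $S_N f=\sum_{n<N}\langle f,\psi_{n,c}^{(\alpha)}\rangle_{\omega_\alpha}\psi_{n,c}^{(\alpha)}$ and $m_\alpha=4.13\left(1.28+\frac{2\alpha+1}{1.9}\right)^{0.55}$. For $s>0$ let $H^s_{per}$ be the space of all $f\in L^2(I)$ with $$\|f\|_{H^s_{per}}^2=\sum_{k\in\mathbb Z}\bigl(1+(k\pi)^2\bigr)^s|b_k(f)|^2<\infty,\qquad b_k(f)=\frac1{\sqrt2}\int_{-1}^1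 f(x)e^{-i\pi kx}\,dx .$$ (1) For all $c>1$ and $\alpha>0$ there exist constants $K>0$ and $a>0$, depending only on $c$ and $\alpha$, such that for every integer $N>m_\alpha c$, every $s>0$ and every $f\in H^s_{per}$, $$\|f-S_Nf\|_{L^2(I,\omega_\alpha)}\le\Bigl(1+\bigl(\tfrac N2\bigr)^2\Bigr)^{-s/2}\|f\|_{H^s_{per}}+K e^{-aN}\|f\|_{L^2(I,\omega_\alpha)} .$$ (2) There is a constant $\delta>0$ such that for all $c\ge 1$ and $\alpha>0$ there is a constant $C=C_{\alpha,c}>0$ with $$\bigl|\langle e^{ik\pi x},\psi_{n,c}^{(\alpha)}\rangle_{\omega_\alpha}\bigr|\le C e^{-\delta n}$$ for every integer $n\ge m_\alpha c$ and every real $k$ with $0<k\le 0.14\,n$. -/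

import Mathlib

open MeasureTheory

noncomputable section

namespace GPSWF

/-- The measure `ω_α(x) dx` on `I = [-1, 1]`, where `ω_α(x) = (1 - x²)^α`. -/
def jacobiMeasure (α : ℝ) : Measure ℝ :=
  (volume.restrict (Set.Icc (-1) 1)).withDensity fun x => ENNReal.ofReal ((1 - x ^ 2) ^ α)

/-- The inner product of `L²(I, ω_α)`, linear in the first argument. -/
def wInner (α : ℝ) (f g : ℝ → ℂ) : ℂ :=
  ∫ x, f x * (starRingEnd ℂ) (g x) ∂jacobiMeasure α

/-- The norm of `L²(I, ω_α)`. -/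
def wNorm (α : ℝ) (f : ℝ → ℂ) : ℝ :=
  (eLpNorm f 2 (jacobiMeasure α)).toReal

/-- The weighted finite Fourier transform
`(F_c f)(x) = ∫_{-1}^{1} e^{icxy} f(y) ω_α(y) dy`. -/
def finiteFourier (α c : ℝ) (f : ℝ → ℂ) (x : ℝ) : ℂ :=
  ∫ y, Complex.exp (Complex.I * c * x * y) * f y ∂jacobiMeasure α

/-- `u ∈ L²(I, ω_α)` satisfies `F_c u = ν u` in `L²(I, ω_α)`. -/
def IsEigen (α c : ℝ) (ν : ℂ) (u : ℝ → ℂ) : Prop :=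
  MemLp u 2 (jacobiMeasure α) ∧
    ∀ᵐ x ∂jacobiMeasure α, finiteFourier α c u x = ν * u x

/-- `ψ₀, ψ₁, …` are the generalized prolate spheroidal wave functions with parameters `α, c`:
the normalized eigenfunctions of `F_c`, all of them up to linear combination (every eigenfunction
orthogonal to all the `ψ n` is zero), listed so that the moduli of the eigenvalues
`μ₀, μ₁, …` decrease. -/
structure IsGPSWF (α c : ℝ) (μ : ℕ → ℂ) (ψ : ℕ → ℝ → ℂ) : Prop where
  eigen : ∀ n, IsEigen α c (μ n) (ψ n)
  orthonormal : ∀ m n, wInner α (ψ m) (ψ n) = if m = n then 1 else 0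
  decreasing : Antitone fun n => ‖μ n‖
  exhaustive : ∀ (ν : ℂ) (u : ℝ → ℂ), IsEigen α c ν u → (∀ n, wInner α u (ψ n) = 0) →
    u =ᵐ[jacobiMeasure α] 0

/-- `S_N f = ∑_{n < N} ⟨f, ψ_n⟩ ψ_n`. -/
def partialSum (α : ℝ) (ψ : ℕ → ℝ → ℂ) (N : ℕ) (f : ℝ → ℂ) (t : ℝ) : ℂ :=
  ∑ n ∈ Finset.range N, wInner α f (ψ n) * ψ n t

/-- The Fourier coefficient `b_k(f) = (1/√2) ∫_{-1}^{1} f(x) e^{-iπkx} dx`. -/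
def fourierB (f : ℝ → ℂ) (k : ℤ) : ℂ :=
  (1 / Real.sqrt 2 : ℝ) * ∫ x in (-1 : ℝ)..1, f x * Complex.exp (-(Complex.I * Real.pi * k * x))

/-- `f ∈ H^s_per`: `f ∈ L²(I)` and `∑_k (1 + (kπ)²)^s |b_k(f)|² < ∞`. -/
def MemHper (s : ℝ) (f : ℝ → ℂ) : Prop :=
  MemLp f 2 (volume.restrict (Set.Icc (-1) 1)) ∧
    Summable fun k : ℤ => (1 + (k * Real.pi) ^ 2) ^ s * ‖fourierB f k‖ ^ 2

/-- The norm of `H^s_per`. -/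
def hperNorm (s : ℝ) (f : ℝ → ℂ) : ℝ :=
  Real.sqrt (∑' k : ℤ, (1 + (k * Real.pi) ^ 2) ^ s * ‖fourierB f k‖ ^ 2)

/-- `m_α = 4.13 (1.28 + (2α+1)/1.9)^{0.55}`. -/
def mConst (α : ℝ) : ℝ :=
  4.13 * (1.28 + (2 * α + 1) / 1.9) ^ (0.55 : ℝ)

end GPSWF

end

/-! Everything rests on one estimate: for `|ξ| ≤ n / 2` the coefficient `⟨e^{iξx}, ψ_n⟩` is at most
`C e^{-n/10}`, with `C` depending only on `α` and `c`.

Eigenvalues: some nonzero `u` in the span of `ψ_0, …, ψ_n` has its first `n` moments equal to zero.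
Then `F_c u` is only a Taylor remainder of size `c^n / n!`, while `‖F_c u‖ ≥ |μ_n| ‖u‖`; so `|μ_n|`
is `O(c^n / n!)` (`norm_eigenvalue_le`).

Moments: the Taylor polynomial of `F_c ψ_n = μ_n ψ_n` of degree below `n` then has `L¹` norm `O(c^n
/ n!)`. A polynomial of degree below `D` has coefficients at most `const · 96^D` times its weighted
`L¹` norm (`norm_coeff_le_integral`), and these coefficients are the moments of `ψ_n` times `(ic)^j
/ j!`. Hence the moments of order up to `7n/8` are super-exponentially small, and so are the
Chebyshev moments. Inserting the Chebyshev expansion of `e^{iξx}` gives the estimate, and with it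
part (2).

Part (1): split `f = g + u`, where `g` keeps the Fourier modes with `|k|π ≤ N/2`. The Sobolev norm
controls `u`, and `I - S_N` is a contraction, so the first term gets constant 1. The estimate
controls `g - S_N g`; its `ℓ¹` sum of Fourier coefficients is bounded by the weighted norm of `g`
times a power of `N`, which the exponential absorbs. Parseval for the `ψ_n` needs completeness: `F_c
= C + iS` with `C`, `S` compact self-adjoint (cosine and sine kernels) and `CS = SC = 0` by parity,
so the spectral theorem applies to `C + S` on the orthogonal complement of the `ψ_n`. -/

namespace GPSWF

/-! ### Coefficients of a polynomial from its values at separated nodes -/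

open Polynomial Finset in
theorem prod_erase_abs_sub (D k : ℕ) (hk : k < D) :
    ∏ l ∈ (range D).erase k, |(k : ℝ) - l| = (k.factorial * (D - 1 - k).factorial : ℕ) := by
  have h1 : (range D).erase k = range k ∪ Ico (k + 1) D := by
    ext l; simp only [mem_erase, mem_range, mem_union, mem_Ico]; omega
  have h2 : Disjoint (range k) (Ico (k + 1) D) := by
    rw [Finset.disjoint_left]; intro l; simp only [mem_range, mem_Ico]; omega
  rw [h1, prod_union h2, Nat.cast_mul]
  congr 1
  · rw [← Finset.prod_range_reflect, ← Finset.prod_range_add_one_eq_factorial, Nat.cast_prod]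
    refine Finset.prod_congr rfl fun l hl => ?_
    have hl' := mem_range.1 hl
    have : ((k - 1 - l : ℕ) : ℝ) = k - 1 - l := by
      rw [Nat.cast_sub (by omega), Nat.cast_sub (by omega)]; simp
    rw [this, abs_of_nonneg] <;> push_cast <;> [ring; (ring_nf; positivity)]
  · rw [Finset.prod_Ico_eq_prod_range, ← Finset.prod_range_add_one_eq_factorial, Nat.cast_prod]
    refine Finset.prod_congr (by congr 1; omega) fun l _ => ?_
    rw [abs_sub_comm, abs_of_nonneg] <;> push_cast <;> [ring; (ring_nf; positivity)]

open Polynomial Finset in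
theorem mahlerMeasure_basisDivisor (x y : ℂ) (hy : ‖y‖ ≤ 1) :
    (Lagrange.basisDivisor x y).mahlerMeasure = ‖x - y‖⁻¹ := by
  rw [Lagrange.basisDivisor, mahlerMeasure_mul, mahlerMeasure_const, mahlerMeasure_X_sub_C,
    max_eq_left hy, mul_one, norm_inv]

-- A coefficient is at most a binomial coefficient times the Mahler measure, and with all roots in
-- the unit disc the Mahler measure is the modulus of the leading coefficient `∏ |x k - x l|⁻¹`.
-- Separation compares this product with factorials; `D^D / D! ≤ e^D ≤ 3^D` and three factors `2^D`
-- give `24^D`.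
open Polynomial Finset in
theorem norm_coeff_basis_le (D : ℕ) (x : ℕ → ℝ) (hx : ∀ k < D, |x k| ≤ 1)
    (hsep : ∀ k < D, ∀ l < D, |(k : ℝ) - l| ≤ 2 * D * |x k - x l|) (k : ℕ) (hk : k < D) (j : ℕ) :
    ‖(Lagrange.basis (range D) (fun l => (x l : ℂ)) k).coeff j‖ ≤ 24 ^ D := by
  have hD : (0 : ℝ) < D := by exact_mod_cast (by omega : 0 < D)
  have hinj : Set.InjOn (fun l => (x l : ℂ)) (range D : Finset ℕ) := by
    intro a ha b hb hab
    have h := hsep a (by simpa using ha) b (by simpa using hb)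
    have : x a = x b := by simpa using hab
    rw [this, sub_self, abs_zero, mul_zero] at h
    have := abs_nonpos_iff.1 h
    exact_mod_cast sub_eq_zero.1 this
  have hM : (Lagrange.basis (range D) (fun l => (x l : ℂ)) k).mahlerMeasure
      = ∏ l ∈ (range D).erase k, |x k - x l|⁻¹ := by
    rw [Lagrange.basis, Finset.prod, prod_mahlerMeasure_eq_mahlerMeasure_prod, Multiset.map_map,
      ← Finset.prod]
    refine Finset.prod_congr rfl fun l hl => ?_
    have hl' : l < D := by simpa using (mem_erase.1 hl).2
    simp only [Function.comp]
    rw [mahlerMeasure_basisDivisor _ _ (by simpa using hx l hl'), ← Complex.ofReal_sub,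
      Complex.norm_real, Real.norm_eq_abs]
  have hfac : (0 : ℝ) < (k.factorial * (D - 1 - k).factorial : ℕ) := by positivity
  have hM2 : ∏ l ∈ (range D).erase k, |x k - x l|⁻¹ ≤
      (2 * D) ^ (D - 1) / (k.factorial * (D - 1 - k).factorial : ℕ) := by
    rw [← prod_erase_abs_sub D k hk]
    have hc : ((range D).erase k).card = D - 1 := by
      rw [card_erase_of_mem (by simpa using hk), card_range]
    rw [← hc, ← Finset.prod_const, ← Finset.prod_div_distrib]
    refine Finset.prod_le_prod (fun l _ => by positivity) fun l hl => ?_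
    have hl' : l < D := by simpa using (mem_erase.1 hl).2
    have hne : (k : ℝ) - l ≠ 0 := by
      rw [sub_ne_zero]; exact_mod_cast (mem_erase.1 hl).1.symm
    have h1 := hsep k hk l hl'
    have h2 : 0 < |(k : ℝ) - l| := abs_pos.2 hne
    have h3 : 0 < |x k - x l| := by
      by_contra h; push Not at h
      nlinarith [abs_nonneg (x k - x l)]
    rw [inv_eq_one_div, div_le_div_iff₀ h3 h2]
    linarith
  have hdeg := Lagrange.natDegree_basis hinj (mem_range.2 hk)
  have h := norm_coeff_le_choose_mul_mahlerMeasure j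
    (Lagrange.basis (range D) (fun l => (x l : ℂ)) k)
  rw [hdeg, hM, card_range] at h
  have hch : (((D - 1).choose j : ℕ) : ℝ) ≤ 2 ^ (D - 1) := by
    exact_mod_cast Nat.choose_le_two_pow _ _
  have hbin : (1 : ℝ) / (k.factorial * (D - 1 - k).factorial : ℕ)
      ≤ 2 ^ (D - 1) / ((D - 1).factorial : ℝ) := by
    rw [div_le_div_iff₀ hfac (by positivity), one_mul]
    have h4 := Nat.choose_mul_factorial_mul_factorial (show k ≤ D - 1 by omega)
    rw [mul_assoc] at h4
    have h5 := Nat.choose_le_two_pow (D - 1) k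
    rw [← h4]
    push_cast
    have h6 : (((D - 1).choose k : ℕ) : ℝ) ≤ 2 ^ (D - 1) := by exact_mod_cast h5
    gcongr
  have hexp : (D : ℝ) ^ (D - 1) / ((D - 1).factorial : ℝ) ≤ 3 ^ D := by
    have h4 : (D : ℝ) ^ D / (D.factorial : ℝ) ≤ Real.exp D :=
      Real.pow_div_factorial_le_exp _ hD.le _
    obtain ⟨m, rfl⟩ : ∃ m, D = m + 1 := ⟨D - 1, by omega⟩
    have h5 : Real.exp ((m + 1 : ℕ) : ℝ) ≤ 3 ^ (m + 1) := by
      rw [← mul_one ((m + 1 : ℕ) : ℝ), Real.exp_nat_mul]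
      gcongr
      linarith [Real.exp_one_lt_d9]
    refine le_trans (le_of_eq ?_) (h4.trans h5)
    rw [Nat.add_sub_cancel, Nat.factorial_succ, pow_succ]
    push_cast
    field_simp
  calc _ ≤ _ := h
    _ ≤ 2 ^ (D - 1) * ((2 * D) ^ (D - 1) / (k.factorial * (D - 1 - k).factorial : ℕ)) := by
        gcongr
    _ = 2 ^ (D - 1) * (2 ^ (D - 1) * D ^ (D - 1)) *
          (1 / (k.factorial * (D - 1 - k).factorial : ℕ)) := by rw [mul_pow]; ring
    _ ≤ 2 ^ (D - 1) * (2 ^ (D - 1) * D ^ (D - 1)) * (2 ^ (D - 1) / ((D - 1).factorial : ℝ)) := by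
        gcongr
    _ = (2 ^ (D - 1)) ^ 3 * (D ^ (D - 1) / ((D - 1).factorial : ℝ)) := by ring
    _ ≤ (2 ^ D) ^ 3 * 3 ^ D := by
        gcongr
        · norm_num
        · omega
    _ = 24 ^ D := by rw [← pow_mul, mul_comm D 3, pow_mul, ← mul_pow]; norm_num

open Polynomial Finset in
theorem norm_coeff_le_sum_eval (D : ℕ) (x : ℕ → ℝ) (hx : ∀ k < D, |x k| ≤ 1)
    (hsep : ∀ k < D, ∀ l < D, |(k : ℝ) - l| ≤ 2 * D * |x k - x l|) (P : ℂ[X])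
    (hP : P.degree < D) (j : ℕ) :
    ‖P.coeff j‖ ≤ 24 ^ D * ∑ k ∈ range D, ‖P.eval (x k : ℂ)‖ := by
  have hinj : Set.InjOn (fun l => (x l : ℂ)) (range D : Finset ℕ) := by
    intro a ha b hb hab
    have h := hsep a (by simpa using ha) b (by simpa using hb)
    have : x a = x b := by simpa using hab
    rw [this, sub_self, abs_zero, mul_zero] at h
    have := abs_nonpos_iff.1 h
    exact_mod_cast sub_eq_zero.1 this
  have hint := Lagrange.eq_interpolate (f := P) hinj (by simpa using hP)
  conv_lhs => rw [hint, Lagrange.interpolate_apply, finsetSum_coeff]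
  rw [Finset.mul_sum]
  refine (norm_sum_le _ _).trans (Finset.sum_le_sum fun k hk => ?_)
  rw [coeff_C_mul, norm_mul, mul_comm]
  gcongr
  exact norm_coeff_basis_le D x hx hsep k (mem_range.1 hk) j

/-! ### The weighted measure -/

theorem jacobiDensity_measurable (α : ℝ) :
    Measurable fun x : ℝ => ENNReal.ofReal ((1 - x ^ 2) ^ α) :=
  ENNReal.measurable_ofReal.comp (((measurable_const.sub (measurable_id.pow_const 2))).pow_const α)

theorem jacobiMeasure_le (α : ℝ) (hα : 0 < α) :
    jacobiMeasure α ≤ volume.restrict (Set.Icc (-1) 1) := by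
  unfold jacobiMeasure
  have h : volume.restrict (Set.Icc (-1 : ℝ) 1) =
      (volume.restrict (Set.Icc (-1) 1)).withDensity 1 := withDensity_one.symm
  conv_rhs => rw [h]
  refine withDensity_mono ?_
  filter_upwards [ae_restrict_mem measurableSet_Icc] with x hx
  simp only [Pi.one_apply, ENNReal.ofReal_le_one]
  exact Real.rpow_le_one (by nlinarith [hx.1, hx.2]) (by nlinarith [sq_nonneg x]) hα.le

theorem jacobiMeasure_univ_le (α : ℝ) (hα : 0 < α) : jacobiMeasure α Set.univ ≤ 2 := by
  refine (jacobiMeasure_le α hα Set.univ).trans ?_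
  simp [Real.volume_Icc]; norm_num

theorem isFiniteMeasure_jacobi (α : ℝ) (hα : 0 < α) : IsFiniteMeasure (jacobiMeasure α) :=
  ⟨(jacobiMeasure_univ_le α hα).trans_lt (by simp)⟩

theorem ae_jacobi_mem (α : ℝ) : ∀ᵐ x ∂jacobiMeasure α, x ∈ Set.Icc (-1 : ℝ) 1 :=
  (withDensity_absolutelyContinuous _ _).ae_le (ae_restrict_mem measurableSet_Icc)

theorem jacobi_real_univ_le (α : ℝ) (hα : 0 < α) : (jacobiMeasure α).real Set.univ ≤ 2 := by
  have h := ENNReal.toReal_mono (by simp) (jacobiMeasure_univ_le α hα)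
  simpa [Measure.real] using h

theorem integral_jacobi {E : Type*} [NormedAddCommGroup E] [NormedSpace ℝ E] (α : ℝ) (g : ℝ → E) :
    ∫ x, g x ∂jacobiMeasure α = ∫ x in Set.Icc (-1 : ℝ) 1, ((1 - x ^ 2) ^ α : ℝ) • g x := by
  unfold jacobiMeasure
  have := integral_withDensity_eq_integral_toReal_smul (μ := volume.restrict (Set.Icc (-1 : ℝ) 1))
    (jacobiDensity_measurable α) (ae_of_all _ fun x => ENNReal.ofReal_lt_top) g
  rw [this]
  refine integral_congr_ae ?_
  filter_upwards [ae_restrict_mem measurableSet_Icc] with x hx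
  rw [ENNReal.toReal_ofReal (Real.rpow_nonneg (by nlinarith [hx.1, hx.2]) _)]

theorem integrable_of_continuous {E : Type*} [NormedAddCommGroup E] (α : ℝ)
    (hα : 0 < α) {g : ℝ → E} (hg : Continuous g) : Integrable g (jacobiMeasure α) :=
  (show Integrable g (volume.restrict (Set.Icc (-1) 1)) from
    hg.continuousOn.integrableOn_compact isCompact_Icc).mono_measure (jacobiMeasure_le α hα)

theorem jacobi_Icc_ge (α : ℝ) (hα : 0 < α) (a b : ℝ) (ha : -(1 / 2) ≤ a)
    (hb : b ≤ 1 / 2) :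
    ENNReal.ofReal ((3 / 4) ^ α * (b - a)) ≤ jacobiMeasure α (Set.Icc a b) := by
  unfold jacobiMeasure
  rw [withDensity_apply _ measurableSet_Icc, Measure.restrict_restrict measurableSet_Icc]
  have hI : Set.Icc a b ∩ Set.Icc (-1) 1 = Set.Icc a b :=
    Set.inter_eq_left.2 (Set.Icc_subset_Icc (by linarith) (by linarith))
  rw [hI, ENNReal.ofReal_mul (by positivity), ← Real.volume_Icc, ← setLIntegral_const]
  refine setLIntegral_mono (jacobiDensity_measurable α) fun x hx => ?_
  refine ENNReal.ofReal_le_ofReal (Real.rpow_le_rpow (by norm_num) ?_ hα.le)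
  nlinarith [hx.1, hx.2]

open Polynomial Finset in
/-- The coefficients of a polynomial of degree less than `D` are bounded exponentially in `D` by
its weighted `L¹` norm. -/
theorem norm_coeff_le_integral (α : ℝ) (hα : 0 < α) (D : ℕ) (P : ℂ[X]) (hP : P.degree < D)
    (j : ℕ) :
    ‖P.coeff j‖ ≤ 2 * (4 / 3) ^ α * 96 ^ D * ∫ x, ‖P.eval (x : ℂ)‖ ∂jacobiMeasure α := by
  have hfin := isFiniteMeasure_jacobi α hα
  have hcont : Continuous fun x : ℝ => ‖P.eval (x : ℂ)‖ :=
    (P.continuous.comp Complex.continuous_ofReal).norm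
  have hint := integrable_of_continuous α hα hcont
  rcases Nat.eq_zero_or_pos D with rfl | hDpos
  · have : P = 0 := by simpa using hP
    simp [this]
  have hD : (0 : ℝ) < D := by exact_mod_cast hDpos
  -- The nodes lie in `D` intervals of length `1/(2D)` separated by gaps `1/(2D)`, all inside
  -- `[-1/2, 1/2]`, where the weight is at least `(3/4)^α`. In each interval some point has `|P|` at
  -- most its average.
  have key : ∀ k : ℕ, ∃ t : ℝ, k < D → (t ∈ Set.Icc (-(1 / 2) + k / D : ℝ) (-(1 / 2) + (k + 1 / 2) / D)
      ∧ ‖P.eval (t : ℂ)‖ ≤ 2 * D * (4 / 3) ^ α * ∫ x, ‖P.eval (x : ℂ)‖ ∂jacobiMeasure α) := by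
    intro k
    by_cases hk : k < D
    swap
    · exact ⟨0, fun h => absurd h hk⟩
    have hk1 : (k : ℝ) + 1 ≤ D := by exact_mod_cast hk
    set a : ℝ := -(1 / 2) + k / D
    set b : ℝ := -(1 / 2) + (k + 1 / 2) / D
    have hab : b - a = 1 / (2 * D) := by simp only [a, b]; field_simp; ring
    have ha : -(1 / 2) ≤ a := by simp only [a]; linarith [show 0 ≤ (k : ℝ) / D by positivity]
    have hb : b ≤ 1 / 2 := by
      have : ((k : ℝ) + 1 / 2) / D ≤ 1 := by rw [div_le_one hD]; linarith
      simp only [b]; linarith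
    have hm := jacobi_Icc_ge α hα a b ha hb
    have hpos : 0 < (3 / 4 : ℝ) ^ α * (b - a) := by rw [hab]; positivity
    have hne : jacobiMeasure α (Set.Icc a b) ≠ 0 :=
      (lt_of_lt_of_le (ENNReal.ofReal_pos.2 hpos) hm).ne'
    obtain ⟨t, ht, hle⟩ := exists_le_setAverage hne (measure_ne_top _ _) hint.integrableOn
    refine ⟨t, fun _ => ⟨ht, hle.trans ?_⟩⟩
    rw [setAverage_eq, smul_eq_mul]
    have hr : (3 / 4 : ℝ) ^ α * (b - a) ≤ (jacobiMeasure α).real (Set.Icc a b) :=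
      (ENNReal.ofReal_le_iff_le_toReal (measure_ne_top _ _)).1 hm
    have hinv : ((jacobiMeasure α).real (Set.Icc a b))⁻¹ ≤ 2 * D * (4 / 3) ^ α := by
      refine (inv_anti₀ hpos hr).trans (le_of_eq ?_)
      rw [hab, mul_inv, ← Real.inv_rpow (by norm_num)]
      norm_num
      ring
    exact mul_le_mul hinv (setIntegral_le_integral hint (ae_of_all _ fun x => norm_nonneg _))
      (integral_nonneg fun x => norm_nonneg _) (by positivity)
  choose x hx using key
  have hsep : ∀ k < D, ∀ l < D, |(k : ℝ) - l| ≤ 2 * D * |x k - x l| := by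
    have aux : ∀ k < D, ∀ l < D, l < k → |(k : ℝ) - l| ≤ 2 * D * |x k - x l| := by
      intro k hk l hl hlk
      have h1 := (hx k hk).1.1
      have h2 := (hx l hl).1.2
      have h3 : (l : ℝ) + 1 ≤ k := by exact_mod_cast hlk
      rw [abs_of_nonneg (by linarith)]
      -- For `k - l ≥ 1` one has `k - l - 1/2 ≥ (k - l)/2`, whence the factor 2 in the separation.
      have h4 : ((k : ℝ) - l - 1 / 2) / D ≤ x k - x l := by
        have : ((k : ℝ) - l - 1 / 2) / D = k / D - (l + 1 / 2) / D := by ring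
        linarith
      rw [div_le_iff₀ hD] at h4
      have := mul_le_mul_of_nonneg_right (le_abs_self (x k - x l)) hD.le
      linarith
    intro k hk l hl
    rcases lt_trichotomy k l with h | h | h
    · rw [abs_sub_comm, abs_sub_comm (x k)]; exact aux l hl k hk h
    · simp [h]
    · exact aux k hk l hl h
  have hx1 : ∀ k < D, |x k| ≤ 1 := by
    intro k hk
    have hk1 : (k : ℝ) + 1 ≤ D := by exact_mod_cast hk
    have h := (hx k hk).1
    have h1 : ((k : ℝ) + 1 / 2) / D ≤ 1 := by rw [div_le_one hD]; linarith
    have h2 : 0 ≤ (k : ℝ) / D := by positivity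
    rw [abs_le]
    exact ⟨by linarith [h.1], by linarith [h.2]⟩
  refine (norm_coeff_le_sum_eval D x hx1 hsep P hP j).trans ?_
  have hI : 0 ≤ ∫ x, ‖P.eval (x : ℂ)‖ ∂jacobiMeasure α := integral_nonneg fun x => norm_nonneg _
  have hsum : ∑ k ∈ range D, ‖P.eval (x k : ℂ)‖ ≤
      D * (2 * D * (4 / 3) ^ α * ∫ x, ‖P.eval (x : ℂ)‖ ∂jacobiMeasure α) := by
    refine (Finset.sum_le_card_nsmul _ _ _ fun k hk => (hx k (mem_range.1 hk)).2).trans ?_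
    simp
  -- The factor `D²` left by the averaging is absorbed in `4^D`, and `24 · 4 = 96`.
  have hD2 : (D : ℝ) ≤ 2 ^ D := by exact_mod_cast Nat.lt_two_pow_self.le
  calc _ ≤ 24 ^ D * (D * (2 * D * (4 / 3) ^ α * ∫ x, ‖P.eval (x : ℂ)‖ ∂jacobiMeasure α)) := by
        gcongr
    _ = 24 ^ D * ((D * D) * (2 * (4 / 3) ^ α * ∫ x, ‖P.eval (x : ℂ)‖ ∂jacobiMeasure α)) := by ring
    _ ≤ 24 ^ D * ((2 ^ D * 2 ^ D) * (2 * (4 / 3) ^ α * ∫ x, ‖P.eval (x : ℂ)‖ ∂jacobiMeasure α)) := by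
        gcongr
    _ = 2 * (4 / 3) ^ α * (24 * 2 * 2) ^ D * ∫ x, ‖P.eval (x : ℂ)‖ ∂jacobiMeasure α := by
        rw [mul_pow, mul_pow]; ring
    _ = _ := by norm_num

/-! ### Taylor expansion of the finite Fourier transform and the moments of eigenfunctions -/

-- Termwise, the tail of the real exponential series obeys `1 / (D + i)! ≤ 1 / (D! i!)`.
open Finset in
theorem norm_exp_sub_sum_le (z : ℂ) (D : ℕ) :
    ‖Complex.exp z - ∑ i ∈ range D, z ^ i / i.factorial‖ ≤
      ‖z‖ ^ D / D.factorial * Real.exp ‖z‖ := by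
  refine (Complex.norm_exp_sub_sum_le_exp_norm_sub_sum z D).trans ?_
  set x := ‖z‖
  have hx : 0 ≤ x := norm_nonneg z
  have hs : HasSum (fun i : ℕ => x ^ i / i.factorial) (Real.exp x) := by
    rw [Real.exp_eq_exp_ℝ]; exact NormedSpace.expSeries_div_hasSum_exp x
  have h1 := (hasSum_nat_add_iff' D).2 hs
  refine hasSum_le (fun i => ?_) h1 (hs.mul_left (x ^ D / D.factorial))
  rw [div_mul_div_comm, ← pow_add, add_comm D i]
  refine div_le_div_of_nonneg_left (by positivity) (by positivity) ?_
  rw [add_comm i D]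
  exact_mod_cast Nat.le_of_dvd (Nat.factorial_pos _) (Nat.factorial_mul_factorial_dvd_factorial_add D i)

/-- The moment `∫ y^i u(y) ω_α(y) dy`. -/
noncomputable def moment (α : ℝ) (u : ℝ → ℂ) (i : ℕ) : ℂ := ∫ y, (y : ℂ) ^ i * u y ∂jacobiMeasure α

theorem integrable_continuous_mul {α : ℝ} {u g : ℝ → ℂ} (hu : Integrable u (jacobiMeasure α))
    (hg : Continuous g) : Integrable (fun y => g y * u y) (jacobiMeasure α) := by
  obtain ⟨B, hB⟩ := isCompact_Icc.exists_bound_of_continuousOn (s := Set.Icc (-1 : ℝ) 1)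
    hg.continuousOn
  refine hu.bdd_mul (c := B) hg.aestronglyMeasurable ?_
  filter_upwards [ae_jacobi_mem α] with x hx using hB x hx

open Finset in
theorem norm_finiteFourier_sub_sum_le {α c : ℝ} (hc : 0 ≤ c) {u : ℝ → ℂ}
    (hu : Integrable u (jacobiMeasure α)) (D : ℕ) {x : ℝ} (hx : x ∈ Set.Icc (-1 : ℝ) 1) :
    ‖finiteFourier α c u x - ∑ i ∈ range D, (Complex.I * c * x) ^ i / i.factorial * moment α u i‖ ≤
      c ^ D / D.factorial * Real.exp c * ∫ y, ‖u y‖ ∂jacobiMeasure α := by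
  have hterm : ∀ i ∈ range D, Integrable (fun y : ℝ =>
      (Complex.I * c * x * y) ^ i / i.factorial * u y) (jacobiMeasure α) := fun i _ =>
    integrable_continuous_mul (g := fun y : ℝ => (Complex.I * c * x * y) ^ i / i.factorial) hu
      (by fun_prop)
  have h1 : ∑ i ∈ range D, (Complex.I * c * x) ^ i / i.factorial * moment α u i =
      ∫ y, ∑ i ∈ range D, (Complex.I * c * x * y) ^ i / i.factorial * u y ∂jacobiMeasure α := by
    rw [integral_finsetSum _ hterm]
    refine Finset.sum_congr rfl fun i _ => ?_
    rw [moment, ← integral_const_mul]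
    congr 1; ext y; rw [mul_pow _ (y : ℂ)]; ring
  have h2 : Integrable (fun y : ℝ => Complex.exp (Complex.I * c * x * y) * u y)
      (jacobiMeasure α) :=
    integrable_continuous_mul (g := fun y : ℝ => Complex.exp (Complex.I * c * x * y)) hu
      (by fun_prop)
  rw [h1, finiteFourier, ← integral_sub h2 (integrable_finsetSum _ hterm), ← integral_const_mul]
  refine norm_integral_le_of_norm_le (hu.norm.const_mul _) ?_
  filter_upwards [ae_jacobi_mem α] with y hy
  rw [← Finset.sum_mul, ← sub_mul, norm_mul]
  refine mul_le_mul_of_nonneg_right ((norm_exp_sub_sum_le _ _).trans ?_) (norm_nonneg _)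
  have hz : ‖Complex.I * c * x * y‖ ≤ c := by
    simp only [norm_mul, Complex.norm_I, Complex.norm_real, Real.norm_eq_abs, one_mul, abs_of_nonneg hc]
    have hx1 : |x| ≤ 1 := abs_le.2 hx
    have hy1 : |y| ≤ 1 := abs_le.2 hy
    calc c * |x| * |y| ≤ c * 1 * 1 := by gcongr
      _ = c := by ring
  gcongr

-- The moments are, up to `(ic)^j / j!`, the coefficients of the Taylor polynomial of `F_c u`. Since
-- `F_c u = ν u`, that polynomial is small in `L¹` as soon as `ν` and the Taylor remainder are
-- small.
open Finset Polynomial in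
theorem norm_moment_le {α c : ℝ} (hα : 0 < α) (hc : 1 ≤ c) {ν : ℂ} {u : ℝ → ℂ}
    (hu : IsEigen α c ν u) (hint : Integrable u (jacobiMeasure α)) (D j : ℕ) (hj : j < D) :
    ‖moment α u j‖ ≤ j.factorial * (2 * (4 / 3) ^ α * 96 ^ D *
      ((‖ν‖ + 2 * Real.exp c * (c ^ D / D.factorial)) * ∫ y, ‖u y‖ ∂jacobiMeasure α)) := by
  have hfin := isFiniteMeasure_jacobi α hα
  have hc0 : 0 ≤ c := by linarith
  set A := ∫ y, ‖u y‖ ∂jacobiMeasure α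
  have hA : 0 ≤ A := integral_nonneg fun y => norm_nonneg _
  set R := c ^ D / D.factorial * Real.exp c * A
  have hR : 0 ≤ R := by positivity
  let P : ℂ[X] := ∑ i ∈ range D, monomial i ((Complex.I * c) ^ i / i.factorial * moment α u i)
  have hP : P.degree < D := by
    rw [degree_lt_iff_coeff_zero]
    intro m hm
    simp only [P, finsetSum_coeff, coeff_monomial]
    refine Finset.sum_eq_zero fun i hi => if_neg ?_
    have := mem_range.1 hi
    omega
  have hcoeff : P.coeff j = (Complex.I * c) ^ j / j.factorial * moment α u j := by
    simp only [P, finsetSum_coeff, coeff_monomial]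
    rw [Finset.sum_ite_eq' (range D) j]
    simp [hj]
  have heval : ∀ x : ℝ, P.eval (x : ℂ) =
      ∑ i ∈ range D, (Complex.I * c * x) ^ i / i.factorial * moment α u i := by
    intro x
    simp only [P, eval_finsetSum, eval_monomial]
    refine Finset.sum_congr rfl fun i _ => ?_
    rw [mul_pow _ (x : ℂ)]; ring
  have hPI : ∫ x, ‖P.eval (x : ℂ)‖ ∂jacobiMeasure α ≤ ‖ν‖ * A + 2 * R := by
    have hint2 : Integrable (fun x => ‖ν‖ * ‖u x‖ + R) (jacobiMeasure α) :=
      (hint.norm.const_mul _).add (integrable_const _)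
    have hcont : Continuous fun x : ℝ => ‖P.eval (x : ℂ)‖ :=
      (P.continuous.comp Complex.continuous_ofReal).norm
    have h := integral_mono_ae (integrable_of_continuous α hα hcont) hint2 (by
      filter_upwards [ae_jacobi_mem α, hu.2] with x hx hux
      have h := norm_finiteFourier_sub_sum_le hc0 hint D hx
      rw [← heval, hux] at h
      have h2 := norm_sub_norm_le (P.eval (x : ℂ)) (ν * u x)
      rw [norm_sub_rev, norm_mul] at h2
      linarith)
    refine h.trans ?_
    rw [integral_add (hint.norm.const_mul _) (integrable_const _), integral_const_mul,
      integral_const, smul_eq_mul]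
    have := mul_le_mul_of_nonneg_right (jacobi_real_univ_le α hα) hR
    linarith
  have h := norm_coeff_le_integral α hα D P hP j
  rw [hcoeff, norm_mul, norm_div, norm_pow, norm_mul, Complex.norm_I, one_mul, Complex.norm_real,
    Real.norm_of_nonneg hc0, Complex.norm_natCast] at h
  -- `c ≥ 1` is what allows the factor `c ^ j` to be dropped.
  have hcj : 1 ≤ c ^ j := one_le_pow₀ hc
  have h3 : ‖moment α u j‖ / j.factorial ≤ c ^ j / j.factorial * ‖moment α u j‖ := by
    rw [div_mul_eq_mul_div]
    gcongr
    exact le_mul_of_one_le_left (norm_nonneg _) hcj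
  have h4 := h3.trans (h.trans (mul_le_mul_of_nonneg_left hPI (by positivity)))
  rw [div_le_iff₀ (by positivity)] at h4
  refine h4.trans (le_of_eq ?_)
  simp only [R]; ring

/-! ### `L²` facts -/

theorem inner_toLp {α : ℝ} {f g : ℝ → ℂ} (hf : MemLp f 2 (jacobiMeasure α))
    (hg : MemLp g 2 (jacobiMeasure α)) :
    inner ℂ (hf.toLp f) (hg.toLp g) = wInner α g f := by
  rw [L2.inner_def, wInner]
  refine integral_congr_ae ?_
  filter_upwards [hf.coeFn_toLp, hg.coeFn_toLp] with x h1 h2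
  rw [h1, h2]; simp

theorem wInner_self (α : ℝ) (f : ℝ → ℂ) :
    wInner α f f = ((∫ x, ‖f x‖ ^ 2 ∂jacobiMeasure α : ℝ) : ℂ) := by
  rw [wInner, ← integral_complex_ofReal]
  congr 1; ext x; rw [Complex.mul_conj, Complex.normSq_eq_norm_sq]

theorem norm_toLp_sq {α : ℝ} {f : ℝ → ℂ} (hf : MemLp f 2 (jacobiMeasure α)) :
    ‖hf.toLp f‖ ^ 2 = ∫ x, ‖f x‖ ^ 2 ∂jacobiMeasure α := by
  have h := inner_toLp hf hf
  rw [inner_self_eq_norm_sq_to_K, wInner_self] at h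
  rw [← Complex.ofReal_inj, ← h, Complex.ofReal_pow]; rfl

theorem wNorm_eq {α : ℝ} {f : ℝ → ℂ} (hf : MemLp f 2 (jacobiMeasure α)) :
    wNorm α f = ‖hf.toLp f‖ := (Lp.norm_toLp f hf).symm

theorem sq_integral_norm_le {α : ℝ} (hα : 0 < α) {u : ℝ → ℂ} (hu : MemLp u 2 (jacobiMeasure α)) :
    (∫ x, ‖u x‖ ∂jacobiMeasure α) ^ 2 ≤ 2 * ∫ x, ‖u x‖ ^ 2 ∂jacobiMeasure α := by
  have hfin := isFiniteMeasure_jacobi α hα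
  have h1 : Integrable (fun x => ‖u x‖) (jacobiMeasure α) := (hu.integrable one_le_two).norm
  have h2 : Integrable (fun x => ‖u x‖ ^ 2) (jacobiMeasure α) := hu.integrable_norm_pow two_ne_zero
  -- Cauchy–Schwarz from `∫ (‖u‖ - t)² ≥ 0`; this `t` is tuned to the bound 2 on the total mass.
  set t := (∫ x, ‖u x‖ ∂jacobiMeasure α) / 2 with ht
  have h3 : 0 ≤ ∫ x, (‖u x‖ ^ 2 - 2 * t * ‖u x‖ + t ^ 2) ∂jacobiMeasure α :=
    integral_nonneg fun x => by
      have := sq_nonneg (‖u x‖ - t)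
      simp only [Pi.zero_apply]; nlinarith
  rw [integral_add (f := fun x => ‖u x‖ ^ 2 - 2 * t * ‖u x‖) (h2.sub (h1.const_mul _)) (integrable_const _),
    integral_sub h2 (h1.const_mul _), integral_const_mul, integral_const, smul_eq_mul] at h3
  have h4 := mul_le_mul_of_nonneg_right (jacobi_real_univ_le α hα) (sq_nonneg t)
  have h5 : ∫ x, ‖u x‖ ∂jacobiMeasure α = 2 * t := by rw [ht]; ring
  rw [h5] at h3 ⊢
  nlinarith

/-! ### Orthonormality and decay of the eigenvalues -/

namespace IsGPSWF

variable {α c : ℝ} {μ : ℕ → ℂ} {ψ : ℕ → ℝ → ℂ}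

theorem memLp (h : IsGPSWF α c μ ψ) (n : ℕ) : MemLp (ψ n) 2 (jacobiMeasure α) := (h.eigen n).1

theorem orthonormal_toLp (h : IsGPSWF α c μ ψ) :
    Orthonormal ℂ fun n => (h.memLp n).toLp (ψ n) := by
  classical
  rw [orthonormal_iff_ite]
  intro i j
  rw [inner_toLp, h.orthonormal]
  simp [eq_comm]

theorem integral_norm_sq (h : IsGPSWF α c μ ψ) (n : ℕ) :
    ∫ x, ‖ψ n x‖ ^ 2 ∂jacobiMeasure α = 1 := by
  have := h.orthonormal n n
  rw [wInner_self] at this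
  simpa using this

theorem integral_norm_le (hα : 0 < α) (h : IsGPSWF α c μ ψ) (n : ℕ) :
    ∫ x, ‖ψ n x‖ ∂jacobiMeasure α ≤ 2 := by
  have h1 := sq_integral_norm_le hα (h.memLp n)
  rw [h.integral_norm_sq] at h1
  nlinarith

theorem integral_norm_sum_sq (h : IsGPSWF α c μ ψ) (s : Finset ℕ) (a : ℕ → ℂ) :
    ∫ x, ‖∑ i ∈ s, a i * ψ i x‖ ^ 2 ∂jacobiMeasure α = ∑ i ∈ s, ‖a i‖ ^ 2 := by
  have hm : MemLp (fun x => ∑ i ∈ s, a i * ψ i x) 2 (jacobiMeasure α) :=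
    memLp_finsetSum s fun i _ => (h.memLp i).const_mul (a i)
  have heq : hm.toLp _ = ∑ i ∈ s, a i • (h.memLp i).toLp (ψ i) := by
    have : ∀ i, a i • (h.memLp i).toLp (ψ i) = ((h.memLp i).const_mul (a i)).toLp _ := fun i =>
      (MemLp.toLp_const_smul (a i) (h.memLp i)).symm
    apply Lp.ext
    refine hm.coeFn_toLp.trans ?_
    have h1 : ∀ᵐ x ∂jacobiMeasure α, ∀ i ∈ s, (a i • (h.memLp i).toLp (ψ i) : Lp ℂ 2 _) x
        = a i * ψ i x := by
      refine (ae_ball_iff (S := (s : Set ℕ)) s.countable_toSet).2 ?_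
      intro i _
      rw [this i]
      exact MemLp.coeFn_toLp _
    filter_upwards [h1, Lp.coeFn_finsetSum s fun i => (a i • (h.memLp i).toLp (ψ i) : Lp ℂ 2 _)]
      with x hx hy
    rw [hy, Finset.sum_apply]
    exact Finset.sum_congr rfl fun i hi => (hx i hi).symm
  rw [← norm_toLp_sq hm, heq]
  have h2 := h.orthonormal_toLp.inner_sum a a s
  rw [inner_self_eq_norm_sq_to_K] at h2
  have h3 : ∀ i, (starRingEnd ℂ) (a i) * a i = ((‖a i‖ ^ 2 : ℝ) : ℂ) := fun i => by
    rw [mul_comm, Complex.mul_conj, Complex.normSq_eq_norm_sq]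
  simp only [h3] at h2
  rw [← Complex.ofReal_inj, Complex.ofReal_pow, Complex.ofReal_sum]; exact h2

/-- The moduli of the eigenvalues decay super-exponentially. -/
theorem norm_eigenvalue_le (hα : 0 < α) (hc : 0 ≤ c) (h : IsGPSWF α c μ ψ) (n : ℕ) :
    ‖μ n‖ ≤ 2 * Real.exp c * (c ^ n / n.factorial) := by
  have hfin := isFiniteMeasure_jacobi α hα
  have hint : ∀ i, Integrable (ψ i) (jacobiMeasure α) := fun i => (h.memLp i).integrable one_le_two
  -- There are `n` moment conditions on `n + 1` coefficients, so a nonzero combination satisfies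
  -- them all.
  let L : (Fin (n + 1) → ℂ) →ₗ[ℂ] (Fin n → ℂ) :=
    Matrix.mulVecLin (Matrix.of fun k i => moment α (ψ i) k)
  obtain ⟨a, haL, ha0⟩ := (Submodule.ne_bot_iff _).1
    (LinearMap.ker_ne_bot_of_finrank_lt (f := L) (by simp))
  let b : ℕ → ℂ := fun i => if hi : i < n + 1 then a ⟨i, hi⟩ else 0
  have hb : ∀ i : Fin (n + 1), b i = a i := fun i => by
    simp only [b, dif_pos i.2]
  let u : ℝ → ℂ := fun x => ∑ i ∈ Finset.range (n + 1), b i * ψ i x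
  have hu : MemLp u 2 (jacobiMeasure α) := memLp_finsetSum _ fun i _ => (h.memLp i).const_mul (b i)
  have hui : Integrable u (jacobiMeasure α) := hu.integrable one_le_two
  have hmom : ∀ k < n, moment α u k = 0 := by
    intro k hk
    have h1 : moment α u k = ∑ i ∈ Finset.range (n + 1), b i * moment α (ψ i) k := by
      simp only [moment, u, Finset.mul_sum]
      rw [integral_finsetSum]
      · refine Finset.sum_congr rfl fun i _ => ?_
        rw [← integral_const_mul]; congr 1; ext y; ring
      · intro i _
        exact integrable_continuous_mul (u := fun y => b i * ψ i y) ((hint i).const_mul _)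
          (g := fun y : ℝ => (y : ℂ) ^ k) (by fun_prop)
    rw [h1, Finset.sum_range]
    have h2 := congrFun (LinearMap.mem_ker.1 haL) ⟨k, hk⟩
    simp only [L, Matrix.mulVecLin_apply, Matrix.mulVec, dotProduct, Matrix.of_apply,
      Pi.zero_apply] at h2
    rw [← h2]
    exact Finset.sum_congr rfl fun i _ => by rw [hb, mul_comm]
  set I := ∫ y, ‖u y‖ ∂jacobiMeasure α
  have hI : 0 ≤ I := integral_nonneg fun y => norm_nonneg _
  set q := c ^ n / n.factorial * Real.exp c with hq
  have hq0 : 0 ≤ q := by positivity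
  -- The Taylor polynomial of `F_c u` vanishes with the moments, which leaves only the remainder.
  have hF : ∀ᵐ x ∂jacobiMeasure α, ‖∑ i ∈ Finset.range (n + 1), (b i * μ i) * ψ i x‖ ≤ q * I := by
    have h1 : ∀ᵐ x ∂jacobiMeasure α, ∀ i, finiteFourier α c (ψ i) x = μ i * ψ i x :=
      ae_all_iff.2 fun i => (h.eigen i).2
    filter_upwards [ae_jacobi_mem α, h1] with x hx hx1
    have h2 := norm_finiteFourier_sub_sum_le hc hui n hx
    rw [Finset.sum_eq_zero (fun i hi => by rw [hmom i (Finset.mem_range.1 hi), mul_zero]),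
      sub_zero] at h2
    have h3 : finiteFourier α c u x = ∑ i ∈ Finset.range (n + 1), (b i * μ i) * ψ i x := by
      simp only [finiteFourier, u, Finset.mul_sum]
      rw [integral_finsetSum]
      · refine Finset.sum_congr rfl fun i _ => ?_
        rw [mul_assoc (b i), ← hx1 i, finiteFourier, ← integral_const_mul]
        congr 1; ext y; ring
      · intro i _
        exact integrable_continuous_mul (u := fun y => b i * ψ i y) ((hint i).const_mul _)
          (g := fun y : ℝ => Complex.exp (Complex.I * c * x * y)) (by fun_prop)
    rwa [h3] at h2
  have h1 := h.integral_norm_sum_sq (Finset.range (n + 1)) b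
  have h2 := h.integral_norm_sum_sq (Finset.range (n + 1)) fun i => b i * μ i
  have h3 : ∫ x, ‖∑ i ∈ Finset.range (n + 1), (b i * μ i) * ψ i x‖ ^ 2 ∂jacobiMeasure α
      ≤ 2 * (q * I) ^ 2 := by
    have hm : MemLp (fun x => ∑ i ∈ Finset.range (n + 1), (b i * μ i) * ψ i x) 2
        (jacobiMeasure α) := memLp_finsetSum _ fun i _ => (h.memLp i).const_mul _
    have := integral_mono_ae (hm.integrable_norm_pow two_ne_zero)
      (integrable_const ((q * I) ^ 2)) (by
        filter_upwards [hF] with x hx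
        exact pow_le_pow_left₀ (norm_nonneg _) hx 2)
    refine this.trans ?_
    rw [integral_const, smul_eq_mul]
    exact mul_le_mul_of_nonneg_right (jacobi_real_univ_le α hα) (sq_nonneg _)
  have h4 := sq_integral_norm_le hα hu
  simp only [u] at h4
  rw [h1] at h4
  set S := ∑ i ∈ Finset.range (n + 1), ‖b i‖ ^ 2
  have hS : 0 < S := by
    obtain ⟨i, hi⟩ := Function.ne_iff.1 ha0
    refine Finset.sum_pos' (fun i _ => sq_nonneg _) ⟨i, Finset.mem_range.2 i.2, ?_⟩
    rw [hb]; exact pow_pos (norm_pos_iff.2 hi) 2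
  have h5 : ‖μ n‖ ^ 2 * S ≤ ∑ i ∈ Finset.range (n + 1), ‖b i * μ i‖ ^ 2 := by
    rw [Finset.mul_sum]
    refine Finset.sum_le_sum fun i hi => ?_
    have h6 : ‖μ n‖ ≤ ‖μ i‖ := h.decreasing (by have := Finset.mem_range.1 hi; omega)
    rw [norm_mul, mul_pow, mul_comm]
    gcongr
  rw [h2] at h3
  have h7 : ‖μ n‖ ^ 2 * S ≤ (2 * q) ^ 2 * S := by
    calc _ ≤ 2 * (q * I) ^ 2 := h5.trans h3
      _ = 2 * q ^ 2 * I ^ 2 := by ring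
      _ ≤ 2 * q ^ 2 * (2 * S) := by gcongr
      _ = _ := by ring
  have h8 := le_of_mul_le_mul_right h7 hS
  have h9 := (sq_le_sq₀ (norm_nonneg _) (by positivity)).1 h8
  refine h9.trans (le_of_eq ?_)
  rw [hq]; ring

end IsGPSWF

/-! ### Chebyshev moments and the coefficients of exponentials -/

open Polynomial in
theorem natDegree_T_nat_le (k : ℕ) : (Chebyshev.T ℂ (k : ℤ)).natDegree ≤ k := by
  simp

open Polynomial in
theorem norm_coeff_T_le (k : ℕ) : ∀ j, ‖(Chebyshev.T ℂ (k : ℤ)).coeff j‖ ≤ 3 ^ k := by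
  induction k using Nat.strong_induction_on with
  | _ k ih =>
    match k with
    | 0 => intro j; rw [Nat.cast_zero, Chebyshev.T_zero, coeff_one]; split_ifs <;> simp
    | 1 => intro j; rw [Nat.cast_one, Chebyshev.T_one, coeff_X]; split_ifs <;> simp
    | k + 2 =>
      intro j
      have h2 := ih k (by omega)
      have h1 := ih (k + 1) (by omega)
      have h : Chebyshev.T ℂ ((k + 2 : ℕ) : ℤ) =
          C 2 * (X * Chebyshev.T ℂ ((k + 1 : ℕ) : ℤ)) - Chebyshev.T ℂ (k : ℤ) := by
        push_cast; rw [Chebyshev.T_add_two, mul_assoc]; rfl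
      have h3 : ‖(X * Chebyshev.T ℂ ((k + 1 : ℕ) : ℤ)).coeff j‖ ≤ 3 ^ (k + 1) := by
        cases j with
        | zero => simp
        | succ j => rw [coeff_X_mul]; exact h1 j
      rw [h, coeff_sub, coeff_C_mul]
      refine (norm_sub_le _ _).trans ?_
      rw [norm_mul, Complex.norm_ofNat]
      have := h2 j
      have h4 : (3 : ℝ) ^ (k + 1) = 3 * 3 ^ k := by ring
      have h5 : (3 : ℝ) ^ (k + 2) = 9 * 3 ^ k := by ring
      have h6 : (0 : ℝ) < 3 ^ k := by positivity
      nlinarith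

open Polynomial in
theorem norm_eval_T_le (k : ℤ) {x : ℝ} (hx : x ∈ Set.Icc (-1 : ℝ) 1) :
    ‖(Chebyshev.T ℂ k).eval (x : ℂ)‖ ≤ 1 := by
  rw [← Real.cos_arccos hx.1 hx.2, Complex.ofReal_cos, Chebyshev.T_complex_cos]
  rw [show (k : ℂ) * (Real.arccos x : ℂ) = ((k * Real.arccos x : ℝ) : ℂ) by push_cast; ring,
    ← Complex.ofReal_cos, Complex.norm_real]
  exact Real.abs_cos_le_one _

theorem hasSum_pow_div_factorial (z : ℂ) :
    HasSum (fun i : ℕ => z ^ i / i.factorial) (Complex.exp z) := by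
  rw [Complex.exp_eq_exp_ℂ]; exact NormedSpace.expSeries_div_hasSum_exp z

theorem hasSum_real_pow_div_factorial (z : ℝ) :
    HasSum (fun i : ℕ => z ^ i / i.factorial) (Real.exp z) := by
  rw [Real.exp_eq_exp_ℝ]; exact NormedSpace.expSeries_div_hasSum_exp z

theorem hasSum_exp_mul_exp (z w : ℂ) :
    HasSum (fun p : ℕ × ℕ => z ^ p.1 / p.1.factorial * (w ^ p.2 / p.2.factorial))
      (Complex.exp (z + w)) := by
  rw [Complex.exp_add]
  exact HasSum.mul (f := fun i : ℕ => z ^ i / i.factorial) (g := fun i : ℕ => w ^ i / i.factorial)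
    (hasSum_pow_div_factorial z) (hasSum_pow_div_factorial w)
    (summable_mul_of_summable_norm (f := fun i : ℕ => z ^ i / i.factorial)
      (g := fun i : ℕ => w ^ i / i.factorial) (hasSum_pow_div_factorial z).summable.norm
      (hasSum_pow_div_factorial w).summable.norm)

theorem hasSum_real_exp_mul_exp (z w : ℝ) :
    HasSum (fun p : ℕ × ℕ => z ^ p.1 / p.1.factorial * (w ^ p.2 / p.2.factorial))
      (Real.exp (z + w)) := by
  rw [Real.exp_add]
  exact HasSum.mul (f := fun i : ℕ => z ^ i / i.factorial) (g := fun i : ℕ => w ^ i / i.factorial)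
    (hasSum_real_pow_div_factorial z) (hasSum_real_pow_div_factorial w)
    (summable_mul_of_summable_norm (f := fun i : ℕ => z ^ i / i.factorial)
      (g := fun i : ℕ => w ^ i / i.factorial) (hasSum_real_pow_div_factorial z).summable.norm
      (hasSum_real_pow_div_factorial w).summable.norm)

open Polynomial in
/-- The Chebyshev expansion of `exp (2 a x)`. -/
theorem hasSum_exp_chebyshev (a : ℂ) {x : ℝ} (hx : x ∈ Set.Icc (-1 : ℝ) 1) :
    HasSum (fun p : ℕ × ℕ => a ^ p.1 / p.1.factorial * (a ^ p.2 / p.2.factorial) *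
      (Chebyshev.T ℂ ((p.1 : ℤ) - p.2)).eval (x : ℂ)) (Complex.exp (2 * a * x)) := by
  set θ : ℂ := (Real.arccos x : ℂ)
  have hxθ : (x : ℂ) = Complex.cos θ := by
    rw [← Complex.ofReal_cos, Real.cos_arccos hx.1 hx.2]
  set w := Complex.exp (θ * Complex.I)
  set w' := Complex.exp (-θ * Complex.I)
  have hcos : 2 * Complex.cos θ = w + w' := Complex.two_cos θ
  -- With `x = cos θ`, `T_{p-q}(x)` is the mean of `e^{i(p-q)θ}` and `e^{-i(p-q)θ}`, so the double
  -- series is the mean of the product series for `e^{aw} e^{aw'}` and for its mirror image.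
  have h1 := hasSum_exp_mul_exp (a * w) (a * w')
  have h2 := hasSum_exp_mul_exp (a * w') (a * w)
  have h3 := (h1.add h2).mul_left (1 / 2)
  have hfun : (fun p : ℕ × ℕ => a ^ p.1 / p.1.factorial * (a ^ p.2 / p.2.factorial) *
      (Chebyshev.T ℂ ((p.1 : ℤ) - p.2)).eval (x : ℂ)) = fun p : ℕ × ℕ => 1 / 2 *
      ((a * w) ^ p.1 / p.1.factorial * ((a * w') ^ p.2 / p.2.factorial) +
        (a * w') ^ p.1 / p.1.factorial * ((a * w) ^ p.2 / p.2.factorial)) := by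
    funext p
    have hT : (Chebyshev.T ℂ ((p.1 : ℤ) - p.2)).eval (x : ℂ) =
        (w ^ p.1 * w' ^ p.2 + w' ^ p.1 * w ^ p.2) / 2 := by
      rw [hxθ, Chebyshev.T_complex_cos, Complex.cos]
      simp only [w, w', ← Complex.exp_nat_mul, ← Complex.exp_add]
      congr 3 <;> push_cast <;> ring_nf
    rw [hT, mul_pow, mul_pow, mul_pow, mul_pow]
    ring
  have hval : Complex.exp (2 * a * x) =
      1 / 2 * (Complex.exp (a * w + a * w') + Complex.exp (a * w' + a * w)) := by
    rw [add_comm (a * w'), ← mul_add, ← hcos, ← hxθ]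
    ring_nf
  rw [hfun, hval]
  exact h3

/-- The Chebyshev moment `∫ T_k(y) u(y) ω_α(y) dy`. -/
noncomputable def chebMoment (α : ℝ) (u : ℝ → ℂ) (k : ℤ) : ℂ :=
  ∫ y, (Polynomial.Chebyshev.T ℂ k).eval (y : ℂ) * u y ∂jacobiMeasure α

theorem continuous_eval_T (k : ℤ) :
    Continuous fun y : ℝ => (Polynomial.Chebyshev.T ℂ k).eval (y : ℂ) :=
  (Polynomial.continuous _).comp Complex.continuous_ofReal

theorem norm_chebMoment_le {α : ℝ} {u : ℝ → ℂ} (hu : Integrable u (jacobiMeasure α)) (k : ℤ) :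
    ‖chebMoment α u k‖ ≤ ∫ y, ‖u y‖ ∂jacobiMeasure α := by
  refine norm_integral_le_of_norm_le hu.norm ?_
  filter_upwards [ae_jacobi_mem α] with y hy
  rw [norm_mul]
  exact mul_le_of_le_one_left (norm_nonneg _) (norm_eval_T_le k hy)

-- There are `k + 1 ≤ 2^k` coefficients, each at most `3^k`, and `2 · 3 = 6`.
open Polynomial in
theorem norm_chebMoment_nat_le {α : ℝ} {u : ℝ → ℂ} (hu : Integrable u (jacobiMeasure α)) (k : ℕ)
    {B : ℝ} (hB : ∀ j ≤ k, ‖moment α u j‖ ≤ B) : ‖chebMoment α u k‖ ≤ 6 ^ k * B := by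
  have h : chebMoment α u k =
      ∑ j ∈ Finset.range (k + 1), (Chebyshev.T ℂ (k : ℤ)).coeff j * moment α u j := by
    simp only [chebMoment, moment]
    simp_rw [eval_eq_sum_range' (Nat.lt_succ_of_le (natDegree_T_nat_le k)), Finset.sum_mul]
    rw [integral_finsetSum]
    · refine Finset.sum_congr rfl fun i _ => ?_
      rw [← integral_const_mul]; congr 1; ext y; ring
    · intro i _
      exact integrable_continuous_mul (g := fun y : ℝ => _ * (y : ℂ) ^ i) hu (by fun_prop)
  have hB0 : 0 ≤ B := (norm_nonneg _).trans (hB 0 (Nat.zero_le _))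
  rw [h]
  refine (norm_sum_le _ _).trans ?_
  have h1 : ∀ j ∈ Finset.range (k + 1),
      ‖(Chebyshev.T ℂ (k : ℤ)).coeff j * moment α u j‖ ≤ 3 ^ k * B := by
    intro j hj
    rw [norm_mul]
    exact mul_le_mul (norm_coeff_T_le k j) (hB j (by have := Finset.mem_range.1 hj; omega))
      (norm_nonneg _) (by positivity)
  refine (Finset.sum_le_card_nsmul _ _ _ h1).trans ?_
  rw [Finset.card_range, nsmul_eq_mul, ← mul_assoc]
  have h2 : ((k + 1 : ℕ) : ℝ) ≤ 2 ^ k := by exact_mod_cast Nat.lt_two_pow_self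
  have h3 : (6 : ℝ) ^ k = 2 ^ k * 3 ^ k := by rw [← mul_pow]; norm_num
  rw [h3]
  gcongr

open Polynomial in
/-- If the Chebyshev moments of low order are small, so is the Fourier transform. -/
theorem norm_integral_exp_mul_le {α : ℝ} {u : ℝ → ℂ} (hu : Integrable u (jacobiMeasure α))
    (ξ τ A r : ℝ) (hA : 0 ≤ A)
    (hk : ∀ k : ℤ, ‖chebMoment α u k‖ ≤ τ + A * Real.exp (|(k : ℝ)| - r)) :
    ‖∫ y, Complex.exp (Complex.I * ξ * y) * u y ∂jacobiMeasure α‖ ≤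
      τ * Real.exp |ξ| + 2 * A * Real.exp (|ξ| / 2 * (Real.exp 1 + Real.exp (-1)) - r) := by
  set a : ℂ := Complex.I * ξ / 2
  set b : ℝ := |ξ| / 2
  have hab : ‖a‖ = b := by simp [a, b]
  let E : ℕ × ℕ → ℂ := fun p => a ^ p.1 / p.1.factorial * (a ^ p.2 / p.2.factorial)
  let G : ℝ → ℝ → ℕ × ℕ → ℝ := fun z w p => z ^ p.1 / p.1.factorial * (w ^ p.2 / p.2.factorial)
  have hE : ∀ p, ‖E p‖ = G b b p := by intro p; simp [E, G, hab]
  let F : ℕ × ℕ → ℝ → ℂ := fun p y =>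
    E p * (Chebyshev.T ℂ ((p.1 : ℤ) - p.2)).eval (y : ℂ) * u y
  have hFint : ∀ p, Integrable (F p) (jacobiMeasure α) := fun p =>
    integrable_continuous_mul (g := fun y : ℝ => E p * _) hu
      (continuous_const.mul (continuous_eval_T _))
  have hFsum : Summable fun p => ∫ y, ‖F p y‖ ∂jacobiMeasure α := by
    refine Summable.of_nonneg_of_le (fun p => integral_nonneg fun y => norm_nonneg _) (fun p => ?_)
      ((hasSum_real_exp_mul_exp b b).summable.mul_right (∫ y, ‖u y‖ ∂jacobiMeasure α))
    change _ ≤ G b b p * _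
    rw [← integral_const_mul]
    refine integral_mono_ae (hFint p).norm (hu.norm.const_mul _) ?_
    filter_upwards [ae_jacobi_mem α] with y hy
    simp only [F]
    rw [norm_mul, norm_mul, hE]
    have h0 : 0 ≤ G b b p := hE p ▸ norm_nonneg _
    exact mul_le_mul_of_nonneg_right (mul_le_of_le_one_right h0 (norm_eval_T_le _ hy))
      (norm_nonneg _)
  have h1 := hasSum_integral_of_summable_integral_norm hFint hFsum
  have h2 : ∫ y, ∑' p, F p y ∂jacobiMeasure α =
      ∫ y, Complex.exp (Complex.I * ξ * y) * u y ∂jacobiMeasure α := by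
    refine integral_congr_ae ?_
    filter_upwards [ae_jacobi_mem α] with y hy
    have h3 := ((hasSum_exp_chebyshev a hy).mul_right (u y)).tsum_eq
    rw [show 2 * a * (y : ℂ) = Complex.I * ξ * y by simp only [a]; ring] at h3
    exact h3
  rw [h2] at h1
  have h4 : ∀ p, ∫ y, F p y ∂jacobiMeasure α = E p * chebMoment α u ((p.1 : ℤ) - p.2) := by
    intro p
    rw [chebMoment, ← integral_const_mul]
    congr 1; ext y; simp only [F]; ring
  simp only [h4] at h1
  have hG1 : HasSum (G b b) (Real.exp |ξ|) := by
    have := hasSum_real_exp_mul_exp b b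
    rwa [show b + b = |ξ| by simp only [b]; ring] at this
  -- The growth `e^{|p-q|}` is at most `e^{p-q} + e^{q-p}`, and each of these factors only rescales
  -- the two arguments of the product series by `e` and `e⁻¹`.
  have hG2 := hasSum_real_exp_mul_exp (b * Real.exp 1) (b * Real.exp (-1))
  have hG3 := hasSum_real_exp_mul_exp (b * Real.exp (-1)) (b * Real.exp 1)
  rw [show b * Real.exp (-1) + b * Real.exp 1 = b * Real.exp 1 + b * Real.exp (-1) by ring] at hG3
  have hbound : HasSum (fun p => G b b p * τ +
      (A * Real.exp (-r)) * (G (b * Real.exp 1) (b * Real.exp (-1)) p +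
        G (b * Real.exp (-1)) (b * Real.exp 1) p))
      (Real.exp |ξ| * τ + (A * Real.exp (-r)) *
        (Real.exp (b * Real.exp 1 + b * Real.exp (-1)) +
          Real.exp (b * Real.exp 1 + b * Real.exp (-1)))) :=
    (hG1.mul_right τ).add ((hG2.add hG3).mul_left _)
  have hb0 : 0 ≤ b := by positivity
  have hGexp : ∀ p : ℕ × ℕ, G (b * Real.exp 1) (b * Real.exp (-1)) p =
      G b b p * Real.exp ((p.1 : ℝ) - p.2) := by
    intro p
    simp only [G, mul_pow, ← Real.exp_nat_mul]
    rw [show (p.1 : ℝ) - p.2 = p.1 * 1 + p.2 * (-1) by ring, Real.exp_add]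
    ring
  have hGexp' : ∀ p : ℕ × ℕ, G (b * Real.exp (-1)) (b * Real.exp 1) p =
      G b b p * Real.exp (-((p.1 : ℝ) - p.2)) := by
    intro p
    simp only [G, mul_pow, ← Real.exp_nat_mul]
    rw [show -((p.1 : ℝ) - p.2) = p.1 * (-1) + p.2 * 1 by ring, Real.exp_add]
    ring
  have hle : ∀ p : ℕ × ℕ, ‖E p * chebMoment α u ((p.1 : ℤ) - p.2)‖ ≤ G b b p * τ +
      (A * Real.exp (-r)) * (G (b * Real.exp 1) (b * Real.exp (-1)) p +
        G (b * Real.exp (-1)) (b * Real.exp 1) p) := by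
    intro p
    rw [norm_mul, hE, hGexp, hGexp']
    have h0 : 0 ≤ G b b p := hE p ▸ norm_nonneg _
    have h5 := hk ((p.1 : ℤ) - p.2)
    rw [Int.cast_sub, Int.cast_natCast, Int.cast_natCast] at h5
    set t : ℝ := (p.1 : ℝ) - p.2
    have h6 : Real.exp |t| ≤ Real.exp t + Real.exp (-t) := by
      rcases abs_cases t with ⟨h, _⟩ | ⟨h, _⟩ <;> rw [h] <;>
        linarith [Real.exp_pos t, Real.exp_pos (-t)]
    rw [sub_eq_add_neg |t|, Real.exp_add] at h5
    calc _ ≤ G b b p * (τ + A * (Real.exp |t| * Real.exp (-r))) := by gcongr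
      _ ≤ G b b p * (τ + A * ((Real.exp t + Real.exp (-t)) * Real.exp (-r))) := by gcongr
      _ = _ := by ring
  rw [← h1.tsum_eq]
  refine (tsum_of_norm_bounded hbound hle).trans (le_of_eq ?_)
  rw [sub_eq_add_neg, Real.exp_add _ (-r), mul_add b]
  ring

/-- Used with `p = n - k`: as `k ≤ 7n/8`, at least `n/8` factorial factors remain, and they beat any
fixed exponential in `n`. -/
theorem pow_div_factorial_le_of_le_mul {Q : ℝ} (hQ : 1 ≤ Q) {n p : ℕ} (h : n ≤ 8 * p) :
    Q ^ n / p.factorial ≤ Real.exp (Q ^ 8) := by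
  have h1 : Q ^ n ≤ (Q ^ 8) ^ p := by
    rw [← pow_mul]; exact pow_le_pow_right₀ hQ h
  calc _ ≤ (Q ^ 8) ^ p / p.factorial := by gcongr
    _ ≤ _ := Real.pow_div_factorial_le_exp _ (by positivity) _

/-- A bound for the low order Chebyshev moments of all the wave functions. -/
noncomputable def chebConst (α c : ℝ) : ℝ :=
  16 * (4 / 3) ^ α * Real.exp c * Real.exp ((576 * c * Real.exp 1) ^ 8)

theorem chebConst_nonneg (α c : ℝ) : 0 ≤ chebConst α c := by
  unfold chebConst; positivity

theorem IsGPSWF.norm_chebMoment_nat_le {α c : ℝ} {μ : ℕ → ℂ} {ψ : ℕ → ℝ → ℂ} (hα : 0 < α)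
    (hc : 1 ≤ c) (h : IsGPSWF α c μ ψ) {n k : ℕ} (hn : 1 ≤ n) (hk : 8 * k ≤ 7 * n) :
    ‖chebMoment α (ψ n) k‖ ≤ chebConst α c * Real.exp (-n) := by
  have hfin := isFiniteMeasure_jacobi α hα
  have hint : Integrable (ψ n) (jacobiMeasure α) := (h.memLp n).integrable one_le_two
  have hμ := h.norm_eigenvalue_le hα (by linarith) n
  have hI := h.integral_norm_le hα n
  have hI0 : 0 ≤ ∫ y, ‖ψ n y‖ ∂jacobiMeasure α := integral_nonneg fun y => norm_nonneg _
  have hc0 : 0 ≤ c := by linarith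
  set B : ℝ := 16 * (4 / 3) ^ α * Real.exp c * ((96 * c) ^ n / (n - k).factorial)
  -- Take `D = n`: the eigenvalue and the Taylor remainder then have the same size, and `j! / n! ≤ 1
  -- / (n - k)!`.
  have hB : ∀ j ≤ k, ‖moment α (ψ n) j‖ ≤ B := by
    intro j hj
    refine (norm_moment_le hα hc (h.eigen n) hint n j (by omega)).trans ?_
    have h1 : (j.factorial : ℝ) / n.factorial ≤ 1 / (n - k).factorial := by
      rw [div_le_div_iff₀ (by positivity) (by positivity), one_mul]
      have h2 : j.factorial * (n - k).factorial ≤ n.factorial := by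
        have h3 : k.factorial * (n - k).factorial ∣ n.factorial :=
          Nat.factorial_mul_factorial_dvd_factorial (by omega)
        exact (Nat.mul_le_mul_right _ (Nat.factorial_le hj)).trans
          (Nat.le_of_dvd (Nat.factorial_pos _) h3)
      exact_mod_cast h2
    calc _ ≤ (j.factorial : ℝ) * (2 * (4 / 3) ^ α * 96 ^ n *
          ((2 * Real.exp c * (c ^ n / n.factorial) + 2 * Real.exp c * (c ^ n / n.factorial)) * 2)) := by
          gcongr
      _ = 16 * (4 / 3) ^ α * Real.exp c * (96 * c) ^ n * ((j.factorial : ℝ) / n.factorial) := by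
          rw [mul_pow]; ring
      _ ≤ 16 * (4 / 3) ^ α * Real.exp c * (96 * c) ^ n * (1 / (n - k).factorial) := by gcongr
      _ = B := by simp only [B]; ring
  refine (GPSWF.norm_chebMoment_nat_le hint k hB).trans ?_
  have he : (1 : ℝ) ≤ Real.exp 1 := Real.one_le_exp (by norm_num)
  have hQ : 1 ≤ 576 * c * Real.exp 1 := by nlinarith
  have h4 := pow_div_factorial_le_of_le_mul hQ (show n ≤ 8 * (n - k) by omega)
  have h5 : (6 : ℝ) ^ k ≤ 6 ^ n := pow_le_pow_right₀ (by norm_num) (by omega)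
  have hexp : Real.exp 1 ^ n * Real.exp (-n) = 1 := by
    rw [← Real.exp_nat_mul, ← Real.exp_add]; simp
  -- `576 = 6 · 96`; the factor `e^n` is put into the power so that `e^{-n}` is left over.
  calc 6 ^ k * B ≤ 6 ^ n * B := by gcongr
    _ = 16 * (4 / 3) ^ α * Real.exp c * ((576 * c) ^ n / (n - k).factorial) *
          (Real.exp 1 ^ n * Real.exp (-n)) := by
        rw [hexp, show (576 : ℝ) * c = 6 * (96 * c) by ring, mul_pow 6]; simp only [B]; ring
    _ = 16 * (4 / 3) ^ α * Real.exp c * ((576 * c * Real.exp 1) ^ n / (n - k).factorial) *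
          Real.exp (-n) := by rw [mul_pow (576 * c)]; ring
    _ ≤ 16 * (4 / 3) ^ α * Real.exp c * Real.exp ((576 * c * Real.exp 1) ^ 8) *
          Real.exp (-n) := by gcongr
    _ = _ := by rw [chebConst]

theorem chebMoment_natAbs (α : ℝ) (u : ℝ → ℂ) (k : ℤ) :
    chebMoment α u k.natAbs = chebMoment α u k := by
  rw [chebMoment, Polynomial.Chebyshev.T_natAbs, chebMoment]

theorem IsGPSWF.norm_integral_exp_le {α c : ℝ} {μ : ℕ → ℂ} {ψ : ℕ → ℝ → ℂ} (hα : 0 < α)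
    (hc : 1 ≤ c) (h : IsGPSWF α c μ ψ) (n : ℕ) (ξ : ℝ) (hξ : |ξ| ≤ n / 2) :
    ‖∫ y, Complex.exp (Complex.I * ξ * y) * ψ n y ∂jacobiMeasure α‖ ≤
      (chebConst α c + 4) * Real.exp (-(1 / 10) * n) := by
  have hfin := isFiniteMeasure_jacobi α hα
  have hint : Integrable (ψ n) (jacobiMeasure α) := (h.memLp n).integrable one_le_two
  have hI := h.integral_norm_le hα n
  have hC := chebConst_nonneg α c
  rcases Nat.eq_zero_or_pos n with rfl | hn
  -- The moment bound requires order below `n`, so `n = 0` is treated by the trivial bound 2.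
  · have h1 : ‖∫ y, Complex.exp (Complex.I * ξ * y) * ψ 0 y ∂jacobiMeasure α‖ ≤
        ∫ y, ‖ψ 0 y‖ ∂jacobiMeasure α := by
      refine norm_integral_le_of_norm_le hint.norm (ae_of_all _ fun y => ?_)
      rw [norm_mul, mul_assoc, mul_comm, ← Complex.ofReal_mul, mul_comm Complex.I,
        Complex.norm_exp_ofReal_mul_I, mul_one]
    simp only [Nat.cast_zero, mul_zero, Real.exp_zero, mul_one]
    linarith
  -- Up to order `7n/8` the moments are small. Beyond it the trivial bound 2 suffices, since the
  -- second exponential is at least 1 there.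
  have hk : ∀ k : ℤ, ‖chebMoment α (ψ n) k‖ ≤
      chebConst α c * Real.exp (-n) + 2 * Real.exp (|(k : ℝ)| - 7 / 8 * n) := by
    intro k
    by_cases hkn : 8 * k.natAbs ≤ 7 * n
    · rw [← chebMoment_natAbs]
      have := h.norm_chebMoment_nat_le hα hc hn hkn
      have h2 := Real.exp_pos (|(k : ℝ)| - 7 / 8 * n)
      linarith
    · have h3 : (7 * n : ℝ) ≤ 8 * |(k : ℝ)| := by
        have h9 : (7 * n : ℝ) ≤ 8 * (k.natAbs : ℝ) := by
          exact_mod_cast (by omega : 7 * n ≤ 8 * k.natAbs)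
        rwa [Nat.cast_natAbs, Int.cast_abs] at h9
      have h4 : 1 ≤ Real.exp (|(k : ℝ)| - 7 / 8 * n) := Real.one_le_exp (by linarith)
      have h5 := (norm_chebMoment_le hint k).trans hI
      have h6 : 0 ≤ chebConst α c * Real.exp (-n) := by positivity
      linarith
  refine (norm_integral_exp_mul_le hint ξ _ 2 _ (by norm_num) hk).trans ?_
  have hn0 : (0 : ℝ) ≤ n := by positivity
  -- With `|ξ| ≤ n/2` the exponent is at most `(3.1/4 - 7/8) n = -n/10`, the source of the rate
  -- `1/10`.
  have he : Real.exp 1 + Real.exp (-1) ≤ 3.1 := by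
    have h1 := Real.exp_one_lt_d9
    have h2 := Real.exp_neg_one_lt_d9
    norm_num at h1 h2 ⊢
    linarith
  have hp := Real.exp_pos 1
  have hp' := Real.exp_pos (-1)
  have h7 : Real.exp (-n) * Real.exp |ξ| ≤ Real.exp (-(1 / 10) * n) := by
    rw [← Real.exp_add]
    exact Real.exp_le_exp.2 (by linarith)
  have h8 : Real.exp (|ξ| / 2 * (Real.exp 1 + Real.exp (-1)) - 7 / 8 * n) ≤
      Real.exp (-(1 / 10) * n) := by
    refine Real.exp_le_exp.2 ?_
    have : |ξ| / 2 * (Real.exp 1 + Real.exp (-1)) ≤ n / 2 / 2 * 3.1 := by gcongr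
    linarith
  rw [mul_assoc]
  nlinarith [mul_le_mul_of_nonneg_left h7 hC]

/-- The coefficients of the exponentials with frequency at most `n / 2` decay exponentially. -/
theorem IsGPSWF.norm_wInner_exp_le {α c : ℝ} {μ : ℕ → ℂ} {ψ : ℕ → ℝ → ℂ} (hα : 0 < α)
    (hc : 1 ≤ c) (h : IsGPSWF α c μ ψ) (n : ℕ) (ξ : ℝ) (hξ : |ξ| ≤ n / 2) :
    ‖wInner α (fun x => Complex.exp (Complex.I * ξ * x)) (ψ n)‖ ≤
      (chebConst α c + 4) * Real.exp (-(1 / 10) * n) := by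
  refine le_trans (le_of_eq ?_) (h.norm_integral_exp_le hα hc n (-ξ) (by rwa [abs_neg]))
  rw [wInner, ← RCLike.norm_conj, ← integral_conj]
  congr 2
  ext x
  rw [map_mul, ← Complex.exp_conj]
  simp

/-! ### Completeness of eigenvectors of a compact normal operator `C + iS` -/

section Operators

variable {H : Type*} [NormedAddCommGroup H] [InnerProductSpace ℂ H]

open InnerProductSpace

theorem eq_zero_of_apply_apply_eq_zero {A : H →L[ℂ] H} (hA : (A : H →ₗ[ℂ] H).IsSymmetric) {u : H}
    (h : A (A u) = 0) : A u = 0 := by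
  have h1 := hA u (A u)
  simp only [ContinuousLinearMap.coe_coe] at h1
  rwa [h, inner_zero_right, inner_self_eq_zero] at h1

theorem conj_eq_of_apply_eq {A : H →L[ℂ] H} (hA : (A : H →ₗ[ℂ] H).IsSymmetric) {u : H} {l : ℂ}
    (h : A u = l • u) (hu : u ≠ 0) : (starRingEnd ℂ) l = l :=
  hA.conj_eigenvalue_eq_self
    (Module.End.hasEigenvalue_of_hasEigenvector ⟨Module.End.mem_eigenspace_iff.2 h, hu⟩)


/-- The operator `∑ᵢ rᵢ ⟨vᵢ, ·⟩ vᵢ`. -/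
noncomputable def rankOneSum (v : ℕ → H) (r : ℕ → ℝ) : H →L[ℂ] H :=
  ∑' i, (r i : ℂ) • rankOne ℂ (v i) (v i)

theorem isCompactOperator_rankOne (x y : H) : IsCompactOperator (rankOne ℂ x y) := by
  rw [rankOne_def']
  have h : IsCompactOperator (innerSL ℂ y) :=
    isCompactOperator_of_locallyCompactSpace_dom (innerSL ℂ y)
  exact h.clm_comp (ContinuousLinearMap.toSpanSingleton ℂ x)

/-- If nonzero, `C u` is an eigenvector of `C` for `m` and `S u` one of `S` for `-im`. Both values
would have to be real, which forces `m = 0` and then `C u = 0`; so one of the two vectors vanishes.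
-/
theorem exists_smul_of_mul_eq_zero {C S : H →L[ℂ] H} (hC : (C : H →ₗ[ℂ] H).IsSymmetric)
    (hS : (S : H →ₗ[ℂ] H).IsSymmetric) (hCS : C * S = 0) (hSC : S * C = 0) {u : H} {m : ℂ}
    (h : C u + Complex.I • S u = m • u) : (∃ a : ℂ, C u = a • u) ∧ ∃ b : ℂ, S u = b • u := by
  have hCS' : ∀ x, C (S x) = 0 := fun x => DFunLike.congr_fun hCS x
  have hSC' : ∀ x, S (C x) = 0 := fun x => DFunLike.congr_fun hSC x
  have h1 : C (C u) = m • C u := by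
    have := congrArg C h
    simpa [hCS'] using this
  have h2 : S (S u) = (-Complex.I * m) • S u := by
    have := congrArg S h
    simp only [map_add, map_smul, hSC', zero_add] at this
    rw [mul_smul, ← this, smul_smul]
    simp
  by_cases hCu : C u = 0
  · refine ⟨⟨0, by simp [hCu]⟩, -Complex.I * m, ?_⟩
    rw [hCu, zero_add] at h
    rw [mul_smul, ← h, smul_smul]; simp
  by_cases hSu : S u = 0
  · exact ⟨⟨m, by simpa [hSu] using h⟩, 0, by simp [hSu]⟩
  exfalso
  have h3 := conj_eq_of_apply_eq hC h1 hCu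
  have h4 := conj_eq_of_apply_eq hS h2 hSu
  rw [map_mul, map_neg, Complex.conj_I, h3] at h4
  have h5 : m = 0 := by
    have : 2 * (Complex.I * m) = 0 := by linear_combination h4
    simpa using this
  exact hCu (eq_zero_of_apply_apply_eq_zero hC (by rw [h1, h5, zero_smul]))

variable [CompleteSpace H]

theorem isCompactOperator_rankOneSum {v : ℕ → H} {r : ℕ → ℝ}
    (hs : Summable fun i => (r i : ℂ) • rankOne ℂ (v i) (v i)) :
    IsCompactOperator (rankOneSum v r) := by
  refine isCompactOperator_of_tendsto hs.hasSum (Filter.Eventually.of_forall fun s => ?_)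
  have h : ∑ i ∈ s, (r i : ℂ) • rankOne ℂ (v i) (v i) ∈ compactOperator (RingHom.id ℂ) H H :=
    Submodule.sum_mem _ fun i _ =>
      IsCompactOperator.smul (isCompactOperator_rankOne (v i) (v i)) (r i : ℂ)
  exact h

theorem isSelfAdjoint_rankOneSum (v : ℕ → H) (r : ℕ → ℝ) : IsSelfAdjoint (rankOneSum v r) := by
  rw [isSelfAdjoint_iff, rankOneSum, tsum_star]
  congr 1
  ext1 i
  rw [star_smul, ContinuousLinearMap.star_eq_adjoint, adjoint_rankOne]
  simp

theorem rankOneSum_mul_eq_zero {v : ℕ → H} {r r' : ℕ → ℝ}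
    (hs : Summable fun i => (r i : ℂ) • rankOne ℂ (v i) (v i))
    (hs' : Summable fun i => (r' i : ℂ) • rankOne ℂ (v i) (v i))
    (h : ∀ i j, (r i : ℂ) * r' j * inner ℂ (v i) (v j) = 0) :
    rankOneSum v r * rankOneSum v r' = 0 := by
  have h0 : ∀ j, rankOneSum v r * ((r' j : ℂ) • rankOne ℂ (v j) (v j)) = 0 := by
    intro j
    rw [rankOneSum, ← hs.tsum_mul_right]
    refine (tsum_congr fun i => ?_).trans tsum_zero
    rw [smul_mul_smul_comm, ContinuousLinearMap.mul_def, rankOne_comp_rankOne, smul_smul, h,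
      zero_smul]
  conv_lhs => rw [rankOneSum.eq_1 v r']
  rw [← hs'.tsum_mul_left]
  exact (tsum_congr h0).trans tsum_zero

/-- A family of eigenvectors of the compact normal operator `C + iS` with no further eigenvector in
its orthogonal complement is total. -/
theorem orthogonal_span_eq_bot {C S : H →L[ℂ] H} (hC : (C : H →ₗ[ℂ] H).IsSymmetric)
    (hS : (S : H →ₗ[ℂ] H).IsSymmetric) (hCc : IsCompactOperator C) (hSc : IsCompactOperator S)
    (hCS : C * S = 0) (hSC : S * C = 0) {ψ : ℕ → H} {μ : ℕ → ℂ}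
    (hψ : ∀ n, C (ψ n) + Complex.I • S (ψ n) = μ n • ψ n)
    (hex : ∀ (l : ℂ) (u : H), C u + Complex.I • S u = l • u → (∀ n, inner ℂ (ψ n) u = 0) → u = 0) :
    (Submodule.span ℂ (Set.range ψ))ᗮ = ⊥ := by
  have hCS' : ∀ x, C (S x) = 0 := fun x => DFunLike.congr_fun hCS x
  have hSC' : ∀ x, S (C x) = 0 := fun x => DFunLike.congr_fun hSC x
  set V := (Submodule.span ℂ (Set.range ψ))ᗮ with hV
  have hmem : ∀ u : H, u ∈ V ↔ ∀ n, inner ℂ (ψ n) u = 0 := by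
    intro u
    rw [hV, Submodule.mem_orthogonal]
    refine ⟨fun h n => h _ (Submodule.subset_span ⟨n, rfl⟩), fun h w hw => ?_⟩
    induction hw using Submodule.span_induction with
    | mem x hx => obtain ⟨n, rfl⟩ := hx; exact h n
    | zero => simp
    | add x y _ _ hx hy => rw [inner_add_left, hx, hy, add_zero]
    | smul a x _ hx => rw [inner_smul_left, hx, mul_zero]
  have hsm := fun n => exists_smul_of_mul_eq_zero hC hS hCS hSC (hψ n)
  have hCV : ∀ u ∈ V, C u ∈ V := by
    intro u hu
    rw [hmem] at hu ⊢
    intro n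
    obtain ⟨a, ha⟩ := (hsm n).1
    have h1 := hC (ψ n) u
    simp only [ContinuousLinearMap.coe_coe] at h1
    rw [← h1, ha, inner_smul_left, hu n, mul_zero]
  have hSV : ∀ u ∈ V, S u ∈ V := by
    intro u hu
    rw [hmem] at hu ⊢
    intro n
    obtain ⟨a, ha⟩ := (hsm n).2
    have h1 := hS (ψ n) u
    simp only [ContinuousLinearMap.coe_coe] at h1
    rw [← h1, ha, inner_smul_left, hu n, mul_zero]
  -- `T` is self-adjoint and compact, so the spectral theorem applies to its restriction to `V`.
  set T := C + S with hT
  have hTc : IsCompactOperator T := hCc.add hSc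
  have hTs : (T : H →ₗ[ℂ] H).IsSymmetric := hC.add hS
  have hTV : ∀ u ∈ V, T u ∈ V := fun u hu => V.add_mem (hCV u hu) (hSV u hu)
  let R : V →L[ℂ] V := T.restrict hTV
  have hRc : IsCompactOperator R := hTc.restrict' hTV
  have hRs : (R : V →ₗ[ℂ] V).IsSymmetric := hTs.restrict_invariant hTV
  have hR0 : R = 0 := by
    rw [← ContinuousLinearMap.eq_zero_of_forall_hasEigenvalue_eq_zero hRc hRs]
    intro l hl
    by_contra hl0
    obtain ⟨p, hp, hp0⟩ := hl.exists_hasEigenvector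
    have hpT : C (p : H) + S (p : H) = l • (p : H) := by
      have := congrArg (Subtype.val) (Module.End.mem_eigenspace_iff.1 hp)
      exact this
    -- `C p` lies in `V` and is an eigenvector of `C + iS` for `l`, because `S C = 0`; likewise `S
    -- p` for `il`. By hypothesis both vanish.
    have hCp : C (p : H) = 0 := by
      refine hex l _ ?_ ((hmem _).1 (hCV _ p.2))
      have := congrArg C hpT
      simp only [map_add, hCS', map_smul, add_zero] at this
      rw [this, hSC', smul_zero, add_zero]
    have hSp : S (p : H) = 0 := by
      refine hex (Complex.I * l) _ ?_ ((hmem _).1 (hSV _ p.2))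
      have := congrArg S hpT
      simp only [map_add, hSC', map_smul, zero_add] at this
      rw [this, hCS', zero_add, smul_smul]
    rw [hCp, hSp, add_zero] at hpT
    rcases smul_eq_zero.1 hpT.symm with h | h
    · exact hl0 h
    · exact hp0 (Subtype.ext h)
  rw [eq_bot_iff]
  intro u hu
  rw [Submodule.mem_bot]
  have hTu : C u + S u = 0 := congrArg Subtype.val (DFunLike.congr_fun hR0 (⟨u, hu⟩ : V))
  have hCu : C u = 0 := by
    refine eq_zero_of_apply_apply_eq_zero hC ?_
    have := congrArg C hTu
    simpa [hCS'] using this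
  have hSu : S u = 0 := by rwa [hCu, zero_add] at hTu
  exact hex 0 u (by simp [hCu, hSu]) ((hmem u).1 hu)

end Operators

/-! ### The finite Fourier transform as a compact normal operator -/

theorem memLp_of_continuous {α : ℝ} (hα : 0 < α) {g : ℝ → ℂ} (hg : Continuous g) :
    MemLp g 2 (jacobiMeasure α) := by
  have hfin := isFiniteMeasure_jacobi α hα
  rw [memLp_two_iff_integrable_sq_norm hg.aestronglyMeasurable]
  exact integrable_of_continuous α hα (hg.norm.pow 2)

/-- The monomial `x ^ i` as an element of `L²(I, ω_α)`. -/
noncomputable def powLp {α : ℝ} (hα : 0 < α) (i : ℕ) : Lp ℂ 2 (jacobiMeasure α) :=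
  (memLp_of_continuous hα (g := fun x : ℝ => (x : ℂ) ^ i) (by fun_prop)).toLp _

theorem inner_powLp {α : ℝ} (hα : 0 < α) {f : ℝ → ℂ} (hf : MemLp f 2 (jacobiMeasure α)) (i : ℕ) :
    inner ℂ (powLp hα i) (hf.toLp f) = moment α f i := by
  rw [powLp, inner_toLp, wInner, moment]
  congr 1; ext x; simp [mul_comm]

theorem norm_powLp_sq_le {α : ℝ} (hα : 0 < α) (i : ℕ) : ‖powLp hα i‖ * ‖powLp hα i‖ ≤ 2 := by
  have hfin := isFiniteMeasure_jacobi α hα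
  rw [← sq, powLp, norm_toLp_sq]
  have h := norm_integral_le_of_norm_le (μ := jacobiMeasure α)
    (f := fun x : ℝ => ‖(x : ℂ) ^ i‖ ^ 2) (integrable_const (1 : ℝ)) (by
      filter_upwards [ae_jacobi_mem α] with x hx
      have hx1 : |x| ≤ 1 := abs_le.2 hx
      simp only [norm_pow, Complex.norm_real, Real.norm_eq_abs, abs_abs]
      exact pow_le_one₀ (by positivity) (pow_le_one₀ (abs_nonneg x) hx1))
  rw [integral_const, smul_eq_mul, mul_one] at h
  exact (le_abs_self _).trans (h.trans (jacobi_real_univ_le α hα))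

theorem integral_pow_odd (α : ℝ) {m : ℕ} (hm : Odd m) : ∫ x, (x : ℂ) ^ m ∂jacobiMeasure α = 0 := by
  rw [integral_jacobi, integral_Icc_eq_integral_Ioc,
    ← intervalIntegral.integral_of_le (by norm_num : (-1 : ℝ) ≤ 1)]
  have h := intervalIntegral.integral_comp_neg (a := -1) (b := 1)
    (fun x : ℝ => ((1 - x ^ 2) ^ α : ℝ) • (x : ℂ) ^ m)
  simp only [even_two.neg_pow, Complex.ofReal_neg, hm.neg_pow, smul_neg, neg_neg,
    intervalIntegral.integral_neg] at h
  exact self_eq_neg.1 h.symm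

/-- The weight is even. This orthogonality makes the cosine and sine operators annihilate each
other. -/
theorem inner_powLp_powLp {α : ℝ} (hα : 0 < α) {i j : ℕ} (h : Odd (i + j)) :
    inner ℂ (powLp hα i) (powLp hα j) = 0 := by
  conv_lhs => rw [powLp.eq_1 hα j]
  rw [inner_powLp, moment, ← integral_pow_odd α h]
  congr 1; ext x; ring

/-- The coefficients of the cosine series. -/
noncomputable def cosCoeff (c : ℝ) (i : ℕ) : ℝ :=
  if Even i then (-1) ^ (i / 2) * (c ^ i / i.factorial) else 0

/-- The coefficients of the sine series. -/
noncomputable def sinCoeff (c : ℝ) (i : ℕ) : ℝ :=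
  if Even i then 0 else (-1) ^ (i / 2) * (c ^ i / i.factorial)

theorem abs_cosCoeff_le (c : ℝ) (i : ℕ) : |cosCoeff c i| ≤ |c| ^ i / i.factorial := by
  unfold cosCoeff
  split_ifs
  · simp [abs_mul, abs_div]
  · simp only [abs_zero]; positivity

theorem abs_sinCoeff_le (c : ℝ) (i : ℕ) : |sinCoeff c i| ≤ |c| ^ i / i.factorial := by
  unfold sinCoeff
  split_ifs
  · simp only [abs_zero]; positivity
  · simp [abs_mul, abs_div]

theorem cosCoeff_add_sinCoeff (c : ℝ) (i : ℕ) :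
    (cosCoeff c i : ℂ) + Complex.I * sinCoeff c i = (Complex.I * c) ^ i / i.factorial := by
  unfold cosCoeff sinCoeff
  rcases Nat.even_or_odd' i with ⟨m, rfl | rfl⟩
  · rw [if_pos (even_two_mul m), if_pos (even_two_mul m), mul_pow, pow_mul Complex.I, Complex.I_sq]
    simp
    ring
  · have h : ¬ Even (2 * m + 1) := by simp
    have h2 : (2 * m + 1) / 2 = m := by omega
    rw [if_neg h, if_neg h, mul_pow, pow_succ Complex.I, pow_mul Complex.I, Complex.I_sq, h2]
    simp
    ring

open InnerProductSpace in
theorem summable_smul_rankOne_powLp {α c : ℝ} (hα : 0 < α) {r : ℕ → ℝ}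
    (hr : ∀ i, |r i| ≤ |c| ^ i / i.factorial) :
    Summable fun i => (r i : ℂ) • rankOne ℂ (powLp hα i) (powLp hα i) := by
  refine Summable.of_norm_bounded ((hasSum_real_pow_div_factorial |c|).summable.mul_right 2)
    fun i => ?_
  rw [norm_smul, norm_rankOne, Complex.norm_real]
  exact mul_le_mul (hr i) (norm_powLp_sq_le hα i) (by positivity) (by positivity)

/-- The operator with kernel `cos (c x y)`. -/
noncomputable def cosOp {α : ℝ} (hα : 0 < α) (c : ℝ) :
    Lp ℂ 2 (jacobiMeasure α) →L[ℂ] Lp ℂ 2 (jacobiMeasure α) :=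
  rankOneSum (powLp hα) (cosCoeff c)

/-- The operator with kernel `sin (c x y)`. -/
noncomputable def sinOp {α : ℝ} (hα : 0 < α) (c : ℝ) :
    Lp ℂ 2 (jacobiMeasure α) →L[ℂ] Lp ℂ 2 (jacobiMeasure α) :=
  rankOneSum (powLp hα) (sinCoeff c)

open InnerProductSpace Filter Topology in
theorem hasSum_cosOp_add_sinOp {α : ℝ} (hα : 0 < α) (c : ℝ) {f : ℝ → ℂ}
    (hf : MemLp f 2 (jacobiMeasure α)) :
    HasSum (fun i : ℕ => ((Complex.I * c) ^ i / i.factorial * moment α f i) • powLp hα i)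
      (cosOp hα c (hf.toLp f) + Complex.I • sinOp hα c (hf.toLp f)) := by
  have h1 := ((ContinuousLinearMap.apply ℂ (Lp ℂ 2 (jacobiMeasure α)) (hf.toLp f)).hasSum
    (summable_smul_rankOne_powLp hα (abs_cosCoeff_le c)).hasSum).add
    (((ContinuousLinearMap.apply ℂ (Lp ℂ 2 (jacobiMeasure α)) (hf.toLp f)).hasSum
    (summable_smul_rankOne_powLp hα (abs_sinCoeff_le c)).hasSum).const_smul Complex.I)
  refine h1.congr_fun fun i => ?_
  rw [← cosCoeff_add_sinCoeff]
  simp only [ContinuousLinearMap.apply_apply, smul_apply, rankOne_apply,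
    inner_powLp]
  module

-- The Taylor series converges to the operator in `L²`, hence almost everywhere along a subsequence,
-- and pointwise on `[-1, 1]` to the integral; the limits agree.
open Filter Topology in
theorem cosOp_add_sinOp_ae {α c : ℝ} (hα : 0 < α) (hc : 0 ≤ c) {f : ℝ → ℂ}
    (hf : MemLp f 2 (jacobiMeasure α)) :
    (cosOp hα c (hf.toLp f) + Complex.I • sinOp hα c (hf.toLp f) : Lp ℂ 2 (jacobiMeasure α))
      =ᵐ[jacobiMeasure α] finiteFourier α c f := by
  have hfin := isFiniteMeasure_jacobi α hα
  have hint := hf.integrable one_le_two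
  have h1 := (hasSum_cosOp_add_sinOp hα c hf).tendsto_sum_nat
  obtain ⟨ns, hns, hlim⟩ := (tendstoInMeasure_of_tendsto_Lp h1).exists_seq_tendsto_ae
  have h2 : ∀ᵐ x ∂jacobiMeasure α, ∀ D : ℕ, (∑ i ∈ Finset.range D,
      ((Complex.I * c) ^ i / i.factorial * moment α f i) • powLp hα i : Lp ℂ 2 _) x =
        ∑ i ∈ Finset.range D, (Complex.I * c * x) ^ i / i.factorial * moment α f i := by
    rw [ae_all_iff]
    intro D
    have h3 : ∀ᵐ x ∂jacobiMeasure α, ∀ i : ℕ,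
        (((Complex.I * c) ^ i / i.factorial * moment α f i) • powLp hα i : Lp ℂ 2 _) x =
          (Complex.I * c * x) ^ i / i.factorial * moment α f i := by
      rw [ae_all_iff]
      intro i
      filter_upwards [Lp.coeFn_smul ((Complex.I * c) ^ i / i.factorial * moment α f i) (powLp hα i),
        (memLp_of_continuous hα (g := fun x : ℝ => (x : ℂ) ^ i) (by fun_prop)).coeFn_toLp]
        with x hx hx2
      rw [hx, Pi.smul_apply, powLp, hx2, mul_pow _ (x : ℂ), smul_eq_mul]
      ring
    filter_upwards [h3, Lp.coeFn_finsetSum (Finset.range D) fun i =>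
      (((Complex.I * c) ^ i / i.factorial * moment α f i) • powLp hα i : Lp ℂ 2 _)] with x hx hy
    rw [hy, Finset.sum_apply]
    exact Finset.sum_congr rfl fun i _ => hx i
  filter_upwards [ae_jacobi_mem α, hlim, h2] with x hx hx1 hx2
  simp only [hx2] at hx1
  suffices key : Tendsto (fun D => ∑ i ∈ Finset.range D,
      (Complex.I * c * x) ^ i / i.factorial * moment α f i) atTop (𝓝 (finiteFourier α c f x)) from
    tendsto_nhds_unique hx1 (key.comp hns.tendsto_atTop)
  rw [tendsto_iff_norm_sub_tendsto_zero]
  have h4 : Tendsto (fun D : ℕ => c ^ D / D.factorial * Real.exp c *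
      ∫ y, ‖f y‖ ∂jacobiMeasure α) atTop (𝓝 0) := by
    have := ((hasSum_real_pow_div_factorial c).summable.tendsto_atTop_zero.mul_const
      (Real.exp c)).mul_const (∫ y, ‖f y‖ ∂jacobiMeasure α)
    simpa using this
  refine squeeze_zero (fun D => norm_nonneg _) (fun D => ?_) h4
  rw [norm_sub_rev]
  exact norm_finiteFourier_sub_sum_le hc hint D hx

theorem isEigen_iff {α c : ℝ} (hα : 0 < α) (hc : 0 ≤ c) {f : ℝ → ℂ}
    (hf : MemLp f 2 (jacobiMeasure α)) (l : ℂ) :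
    IsEigen α c l f ↔
      cosOp hα c (hf.toLp f) + Complex.I • sinOp hα c (hf.toLp f) = l • hf.toLp f := by
  have h1 := cosOp_add_sinOp_ae hα hc hf
  have h2 := Lp.coeFn_smul l (hf.toLp f)
  have h3 := hf.coeFn_toLp
  constructor
  · intro h
    apply Lp.ext
    filter_upwards [h1, h2, h3, h.2] with x h1 h2 h3 h4
    rw [h1, h2, Pi.smul_apply, h3, h4, smul_eq_mul]
  · intro h
    refine ⟨hf, ?_⟩
    rw [h] at h1
    filter_upwards [h1, h2, h3] with x h1 h2 h3
    rw [← h1, h2, Pi.smul_apply, h3, smul_eq_mul]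

theorem IsGPSWF.orthogonal_span_eq_bot {α c : ℝ} {μ : ℕ → ℂ} {ψ : ℕ → ℝ → ℂ} (hα : 0 < α)
    (hc : 0 ≤ c) (h : IsGPSWF α c μ ψ) :
    (Submodule.span ℂ (Set.range fun n => (h.memLp n).toLp (ψ n)))ᗮ = ⊥ := by
  have hsc := summable_smul_rankOne_powLp hα (abs_cosCoeff_le c)
  have hss := summable_smul_rankOne_powLp hα (abs_sinCoeff_le c)
  refine GPSWF.orthogonal_span_eq_bot (C := cosOp hα c) (S := sinOp hα c) (μ := μ)
    (isSelfAdjoint_rankOneSum _ _).isSymmetric (isSelfAdjoint_rankOneSum _ _).isSymmetric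
    (isCompactOperator_rankOneSum hsc) (isCompactOperator_rankOneSum hss)
    (rankOneSum_mul_eq_zero hsc hss fun i j => ?_) (rankOneSum_mul_eq_zero hss hsc fun i j => ?_)
    (fun n => (isEigen_iff hα hc (h.memLp n) (μ n)).1 (h.eigen n)) fun l u hu hort => ?_
  · by_cases hi : Even i
    · by_cases hj : Even j
      · simp [sinCoeff, hj]
      · rw [inner_powLp_powLp hα (hi.add_odd (Nat.not_even_iff_odd.1 hj)), mul_zero]
    · simp [cosCoeff, hi]
  · by_cases hi : Even i
    · simp [sinCoeff, hi]
    · by_cases hj : Even j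
      · rw [inner_powLp_powLp hα ((Nat.not_even_iff_odd.1 hi).add_even hj), mul_zero]
      · simp [cosCoeff, hj]
  · have hm : MemLp u 2 (jacobiMeasure α) := Lp.memLp u
    have hu' : hm.toLp u = u := Lp.toLp_coeFn u hm
    have he : IsEigen α c l u := (isEigen_iff hα hc hm l).2 (by rw [hu', hu])
    have h0 := h.exhaustive l u he fun n => by
      rw [← inner_toLp (h.memLp n) hm, hu']
      exact hort n
    rw [← hu']
    exact (MemLp.toLp_eq_toLp_iff hm MemLp.zero).2 h0

/-- Parseval's identity for the wave functions. -/
theorem IsGPSWF.hasSum_norm_sq {α c : ℝ} {μ : ℕ → ℂ} {ψ : ℕ → ℝ → ℂ} (hα : 0 < α)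
    (hc : 0 ≤ c) (h : IsGPSWF α c μ ψ) {f : ℝ → ℂ} (hf : MemLp f 2 (jacobiMeasure α)) :
    HasSum (fun n => ‖wInner α f (ψ n)‖ ^ 2) (wNorm α f ^ 2) := by
  let b := HilbertBasis.mkOfOrthogonalEqBot h.orthonormal_toLp (h.orthogonal_span_eq_bot hα hc)
  have h1 := b.hasSum_inner_mul_inner (hf.toLp f) (hf.toLp f)
  have h2 : ∀ n, b n = (h.memLp n).toLp (ψ n) := fun n => by
    simp only [b, HilbertBasis.coe_mkOfOrthogonalEqBot]
  have h3 : ∀ n, inner ℂ (hf.toLp f) (b n) * inner ℂ (b n) (hf.toLp f) =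
      ((‖wInner α f (ψ n)‖ ^ 2 : ℝ) : ℂ) := by
    intro n
    rw [← inner_conj_symm, h2, inner_toLp, mul_comm, Complex.mul_conj, Complex.normSq_eq_norm_sq]
  simp only [h3] at h1
  rw [inner_self_eq_norm_sq_to_K, ← wNorm_eq hf] at h1
  have h4 := Complex.reCLM.hasSum h1
  simpa [← Complex.ofReal_pow] using h4

/-! ### Partial sums -/

theorem integrable_mul_conj {α : ℝ} {f g : ℝ → ℂ} (hf : MemLp f 2 (jacobiMeasure α))
    (hg : MemLp g 2 (jacobiMeasure α)) :
    Integrable (fun x => f x * (starRingEnd ℂ) (g x)) (jacobiMeasure α) :=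
  hf.integrable_mul (q := 2) hg.star

theorem wInner_sub_left {α : ℝ} {f g u : ℝ → ℂ} (hf : MemLp f 2 (jacobiMeasure α))
    (hg : MemLp g 2 (jacobiMeasure α)) (hu : MemLp u 2 (jacobiMeasure α)) :
    wInner α (fun x => f x - g x) u = wInner α f u - wInner α g u := by
  rw [wInner, wInner, wInner, ← integral_sub (integrable_mul_conj hf hu) (integrable_mul_conj hg hu)]
  congr 1; ext x; ring

theorem wInner_sum_left {ι : Type*} {α : ℝ} (s : Finset ι) (a : ι → ℂ) {f : ι → ℝ → ℂ} {u : ℝ → ℂ}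
    (hf : ∀ i, MemLp (f i) 2 (jacobiMeasure α)) (hu : MemLp u 2 (jacobiMeasure α)) :
    wInner α (fun x => ∑ i ∈ s, a i * f i x) u = ∑ i ∈ s, a i * wInner α (f i) u := by
  simp only [wInner, Finset.sum_mul]
  rw [integral_finsetSum]
  · refine Finset.sum_congr rfl fun i _ => ?_
    rw [← integral_const_mul]; congr 1; ext x; ring
  · intro i _
    exact integrable_mul_conj ((hf i).const_mul (a i)) hu

theorem wNorm_nonneg (α : ℝ) (f : ℝ → ℂ) : 0 ≤ wNorm α f := ENNReal.toReal_nonneg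

theorem wNorm_sq {α : ℝ} {f : ℝ → ℂ} (hf : MemLp f 2 (jacobiMeasure α)) :
    wNorm α f ^ 2 = ∫ x, ‖f x‖ ^ 2 ∂jacobiMeasure α := by
  rw [wNorm_eq hf, norm_toLp_sq]

theorem wNorm_add_le {α : ℝ} {f g : ℝ → ℂ} (hf : MemLp f 2 (jacobiMeasure α))
    (hg : MemLp g 2 (jacobiMeasure α)) :
    wNorm α (fun x => f x + g x) ≤ wNorm α f + wNorm α g := by
  have h : wNorm α (fun x => f x + g x) = ‖(hf.add hg).toLp (f + g)‖ := wNorm_eq (hf.add hg)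
  rw [h, wNorm_eq hf, wNorm_eq hg, MemLp.toLp_add]
  exact norm_add_le _ _

theorem wNorm_sub_le {α : ℝ} {f g : ℝ → ℂ} (hf : MemLp f 2 (jacobiMeasure α))
    (hg : MemLp g 2 (jacobiMeasure α)) :
    wNorm α (fun x => f x - g x) ≤ wNorm α f + wNorm α g := by
  have h : wNorm α (fun x => f x - g x) = ‖(hf.sub hg).toLp (f - g)‖ := wNorm_eq (hf.sub hg)
  rw [h, wNorm_eq hf, wNorm_eq hg, MemLp.toLp_sub]
  exact norm_sub_le _ _

namespace IsGPSWF

variable {α c : ℝ} {μ : ℕ → ℂ} {ψ : ℕ → ℝ → ℂ}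

theorem memLp_partialSum (h : IsGPSWF α c μ ψ) (N : ℕ) (f : ℝ → ℂ) :
    MemLp (partialSum α ψ N f) 2 (jacobiMeasure α) :=
  memLp_finsetSum _ fun i _ => (h.memLp i).const_mul _

theorem wInner_sub_partialSum (h : IsGPSWF α c μ ψ) (N n : ℕ) {f : ℝ → ℂ}
    (hf : MemLp f 2 (jacobiMeasure α)) :
    wInner α (fun t => f t - partialSum α ψ N f t) (ψ n) =
      if n < N then 0 else wInner α f (ψ n) := by
  rw [wInner_sub_left hf (h.memLp_partialSum N f) (h.memLp n)]
  have h1 : wInner α (partialSum α ψ N f) (ψ n) =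
      ∑ i ∈ Finset.range N, wInner α f (ψ i) * wInner α (ψ i) (ψ n) :=
    wInner_sum_left (Finset.range N) (fun i => wInner α f (ψ i)) h.memLp (h.memLp n)
  simp only [h.orthonormal, mul_ite, mul_one, mul_zero, Finset.sum_ite_eq', Finset.mem_range] at h1
  rw [h1]
  split_ifs <;> simp

theorem wNorm_sub_partialSum_le (hα : 0 < α) (hc : 0 ≤ c) (h : IsGPSWF α c μ ψ) (N : ℕ)
    {f : ℝ → ℂ} (hf : MemLp f 2 (jacobiMeasure α)) :
    wNorm α (fun t => f t - partialSum α ψ N f t) ≤ wNorm α f := by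
  have h1 := h.hasSum_norm_sq hα hc (hf.sub (h.memLp_partialSum N f))
  have h2 := h.hasSum_norm_sq hα hc hf
  refine (sq_le_sq₀ (wNorm_nonneg _ _) (wNorm_nonneg _ _)).1 (hasSum_le (fun n => ?_) h1 h2)
  have h3 := h.wInner_sub_partialSum N n hf
  change ‖wInner α (fun t => f t - partialSum α ψ N f t) (ψ n)‖ ^ 2 ≤ _
  rw [h3]
  split_ifs
  · simp
  · exact le_rfl

theorem wNorm_sub_partialSum_le_exp (hα : 0 < α) (hc : 0 ≤ c) (h : IsGPSWF α c μ ψ) (N : ℕ)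
    {f : ℝ → ℂ} (hf : MemLp f 2 (jacobiMeasure α)) {L : ℝ} (hL : 0 ≤ L)
    (hdecay : ∀ n, N ≤ n → ‖wInner α f (ψ n)‖ ≤ L * Real.exp (-(1 / 10) * n)) :
    wNorm α (fun t => f t - partialSum α ψ N f t) ≤ 3 * L * Real.exp (-(1 / 10) * N) := by
  have h1 := h.hasSum_norm_sq hα hc (hf.sub (h.memLp_partialSum N f))
  set ρ := Real.exp (-(1 / 5)) with hρ
  have hρ0 : 0 < ρ := Real.exp_pos _
  -- This gives `(1 - ρ)⁻¹ ≤ 6`; it is rounded up to `9 = 3²` so that the square root is the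
  -- constant 3.
  have hρ1 : ρ ≤ 5 / 6 := by
    have h2 := Real.add_one_le_exp (1 / 5 : ℝ)
    rw [hρ, Real.exp_neg]
    rw [show (5 / 6 : ℝ) = (6 / 5)⁻¹ by norm_num]
    exact inv_anti₀ (by norm_num) (by linarith)
  have hpow : ∀ n : ℕ, Real.exp (-(1 / 10) * n) ^ 2 = ρ ^ n := fun n => by
    rw [hρ, ← Real.exp_nat_mul, ← Real.exp_nat_mul]; congr 1; push_cast; ring
  have hgeo : HasSum (fun n : ℕ => if n < N then 0 else L ^ 2 * ρ ^ n)
      (L ^ 2 * ρ ^ N * (1 - ρ)⁻¹) := by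
    rw [← hasSum_nat_add_iff' N, Finset.sum_eq_zero (fun i hi => if_pos (Finset.mem_range.1 hi)),
      sub_zero]
    have h3 := (hasSum_geometric_of_lt_one hρ0.le (by linarith)).mul_left (L ^ 2 * ρ ^ N)
    refine h3.congr_fun fun n => ?_
    rw [if_neg (by omega), pow_add]; ring
  have h4 : wNorm α (fun t => f t - partialSum α ψ N f t) ^ 2 ≤ L ^ 2 * ρ ^ N * (1 - ρ)⁻¹ := by
    refine hasSum_le (fun n => ?_) h1 hgeo
    change ‖wInner α (fun t => f t - partialSum α ψ N f t) (ψ n)‖ ^ 2 ≤ _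
    rw [h.wInner_sub_partialSum N n hf]
    split_ifs with hn
    · simp
    · rw [← hpow, ← mul_pow]
      exact pow_le_pow_left₀ (norm_nonneg _) (hdecay n (by omega)) 2
  have h5 : (1 - ρ)⁻¹ ≤ 9 := by
    rw [show (9 : ℝ) = (1 / 9)⁻¹ by norm_num]
    exact inv_anti₀ (by norm_num) (by linarith)
  refine (sq_le_sq₀ (wNorm_nonneg _ _) (by positivity)).1 (h4.trans ?_)
  calc _ ≤ L ^ 2 * ρ ^ N * 9 := by gcongr
    _ = _ := by rw [mul_pow, hpow]; ring

end IsGPSWF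

/-! ### Fourier series on `[-1, 1]` -/

theorem intervalIntegrable_of_memLp {f : ℝ → ℂ}
    (hf : MemLp f 2 (volume.restrict (Set.Icc (-1) 1))) :
    IntervalIntegrable f volume (-1) 1 := by
  have h : Integrable f (volume.restrict (Set.Icc (-1) 1)) := hf.integrable one_le_two
  rw [intervalIntegrable_iff_integrableOn_Icc_of_le (by norm_num)]
  exact h

theorem fourierB_sub {f g : ℝ → ℂ} (hf : MemLp f 2 (volume.restrict (Set.Icc (-1) 1)))
    (hg : MemLp g 2 (volume.restrict (Set.Icc (-1) 1))) (k : ℤ) :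
    fourierB (fun x => f x - g x) k = fourierB f k - fourierB g k := by
  have hc : ContinuousOn (fun x : ℝ => Complex.exp (-(Complex.I * Real.pi * k * x)))
      (Set.uIcc (-1) 1) := by fun_prop
  simp only [fourierB, sub_mul]
  rw [intervalIntegral.integral_sub ((intervalIntegrable_of_memLp hf).mul_continuousOn hc)
    ((intervalIntegrable_of_memLp hg).mul_continuousOn hc), mul_sub]

theorem hasSum_norm_fourierB_sq {f : ℝ → ℂ} (hf : MemLp f 2 (volume.restrict (Set.Icc (-1) 1))) :
    HasSum (fun k : ℤ => ‖fourierB f k‖ ^ 2) (∫ x in Set.Icc (-1 : ℝ) 1, ‖f x‖ ^ 2) := by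
  have hf' : MemLp f 2 (volume.restrict (Set.Ioc (-1) 1)) := by
    rwa [restrict_Ioc_eq_restrict_Icc]
  -- `fourierCoeffOn` carries the factor `1/2` where `fourierB` has `1/√2`, hence the 2 on squares.
  have h := (hasSum_sq_fourierCoeffOn (by norm_num : (-1 : ℝ) < 1) hf').mul_left 2
  rw [integral_Icc_eq_integral_Ioc, ← intervalIntegral.integral_of_le (by norm_num)]
  rw [show 2 * ((1 : ℝ) - -1)⁻¹ • ∫ x in (-1 : ℝ)..1, ‖f x‖ ^ 2 =
    ∫ x in (-1 : ℝ)..1, ‖f x‖ ^ 2 by rw [smul_eq_mul]; ring] at h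
  refine h.congr_fun fun k => ?_
  rw [fourierCoeffOn_eq_integral, fourierB, norm_mul, norm_smul, mul_pow, mul_pow]
  have h1 : ∫ x in (-1 : ℝ)..1, f x * Complex.exp (-(Complex.I * Real.pi * k * x)) =
      ∫ x in (-1 : ℝ)..1, fourier (-k) (x : AddCircle ((1 : ℝ) - (-1))) • f x := by
    congr 1; ext x
    rw [fourier_coe_apply, smul_eq_mul, mul_comm]
    congr 2
    push_cast
    ring
  rw [h1, Complex.norm_real, Real.norm_eq_abs, Real.norm_eq_abs, sq_abs, sq_abs, div_pow,
    Real.sq_sqrt (by norm_num)]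
  ring

/-- The trigonometric polynomial with Fourier coefficients `b k`, `k ∈ S`. -/
noncomputable def trigPoly (S : Finset ℤ) (b : ℤ → ℂ) (x : ℝ) : ℂ :=
  ∑ k ∈ S, (b k / Real.sqrt 2) * Complex.exp (Complex.I * (k * Real.pi : ℝ) * x)

theorem continuous_trigPoly (S : Finset ℤ) (b : ℤ → ℂ) : Continuous (trigPoly S b) := by
  unfold trigPoly; fun_prop

theorem integral_exp_int (m : ℤ) :
    ∫ x in (-1 : ℝ)..1, Complex.exp (Complex.I * Real.pi * m * x) = if m = 0 then 2 else 0 := by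
  split_ifs with h
  · simp [h]; norm_num
  · have hne : Complex.I * Real.pi * m ≠ 0 := by simp [h, Real.pi_ne_zero]
    rw [integral_exp_mul_complex hne, div_eq_zero_iff]
    left
    rw [sub_eq_zero, Complex.exp_eq_exp_iff_exists_int]
    exact ⟨m, by push_cast; ring⟩

theorem fourierB_trigPoly (S : Finset ℤ) (b : ℤ → ℂ) (k : ℤ) :
    fourierB (trigPoly S b) k = if k ∈ S then b k else 0 := by
  have h2 : (Real.sqrt 2 : ℂ) * Real.sqrt 2 = 2 := by
    rw [← Complex.ofReal_mul, Real.mul_self_sqrt (by norm_num)]; simp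
  have h2' : (Real.sqrt 2 : ℂ) ≠ 0 := by
    intro h; rw [h] at h2; norm_num at h2
  have h1 : ∫ x in (-1 : ℝ)..1, trigPoly S b x * Complex.exp (-(Complex.I * Real.pi * k * x)) =
      ∑ j ∈ S, (b j / Real.sqrt 2) * (if j - k = 0 then 2 else 0) := by
    simp only [trigPoly, Finset.sum_mul]
    rw [intervalIntegral.integral_finsetSum]
    · refine Finset.sum_congr rfl fun j _ => ?_
      rw [← integral_exp_int, ← intervalIntegral.integral_const_mul]
      congr 1; ext x
      rw [mul_assoc, ← Complex.exp_add]
      congr 2; push_cast; ring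
    · intro j _
      exact Continuous.intervalIntegrable (by fun_prop) _ _
  rw [fourierB, h1]
  simp only [sub_eq_zero, mul_ite, mul_zero, Finset.sum_ite_eq']
  split_ifs with hk
  · push_cast
    field_simp
    rw [sq, h2, mul_comm]
  · simp

theorem memLp_Icc_of_continuous {g : ℝ → ℂ} (hg : Continuous g) :
    MemLp g 2 (volume.restrict (Set.Icc (-1) 1)) := by
  rw [memLp_two_iff_integrable_sq_norm hg.aestronglyMeasurable]
  exact (hg.norm.pow 2).continuousOn.integrableOn_compact isCompact_Icc

theorem integral_norm_trigPoly_sq (S : Finset ℤ) (b : ℤ → ℂ) :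
    ∫ x in Set.Icc (-1 : ℝ) 1, ‖trigPoly S b x‖ ^ 2 = ∑ k ∈ S, ‖b k‖ ^ 2 := by
  have h := hasSum_norm_fourierB_sq (memLp_Icc_of_continuous (continuous_trigPoly S b))
  refine h.unique ?_
  have h2 : HasSum (fun k : ℤ => ‖fourierB (trigPoly S b) k‖ ^ 2)
      (∑ k ∈ S, ‖fourierB (trigPoly S b) k‖ ^ 2) :=
    hasSum_sum_of_ne_finset_zero fun k hk => by simp [fourierB_trigPoly, hk]
  rwa [Finset.sum_congr rfl fun k hk => by rw [fourierB_trigPoly, if_pos hk]] at h2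

theorem norm_trigPoly_sq_le (S : Finset ℤ) (b : ℤ → ℂ) (x : ℝ) :
    ‖trigPoly S b x‖ ^ 2 ≤ S.card / 2 * ∑ k ∈ S, ‖b k‖ ^ 2 := by
  have h1 : ‖trigPoly S b x‖ ≤ ∑ k ∈ S, ‖b k‖ / Real.sqrt 2 := by
    refine (norm_sum_le _ _).trans (Finset.sum_le_sum fun k _ => ?_)
    rw [norm_mul, norm_div, mul_assoc, ← Complex.ofReal_mul, mul_comm Complex.I,
      Complex.norm_exp_ofReal_mul_I, mul_one, Complex.norm_real,
      Real.norm_of_nonneg (Real.sqrt_nonneg _)]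
  refine (pow_le_pow_left₀ (norm_nonneg _) h1 2).trans ?_
  rw [← Finset.sum_div, div_pow, Real.sq_sqrt (by norm_num), div_mul_eq_mul_div]
  exact div_le_div_of_nonneg_right (sq_sum_le_card_mul_sum_sq (s := S) (f := fun k => ‖b k‖))
    (by norm_num)

/-- The unweighted norm of a trigonometric polynomial is controlled by its weighted norm. -/
theorem sum_sq_le_wNorm_trigPoly {α : ℝ} (hα : 0 < α) {S : Finset ℤ} (hS : S.Nonempty)
    (b : ℤ → ℂ) :
    ∑ k ∈ S, ‖b k‖ ^ 2 ≤ 2 * (2 * S.card : ℝ) ^ α * wNorm α (trigPoly S b) ^ 2 := by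
  set β := ∑ k ∈ S, ‖b k‖ ^ 2 with hβ
  set g := trigPoly S b
  have hg : Continuous g := continuous_trigPoly S b
  have hβ0 : 0 ≤ β := Finset.sum_nonneg fun k _ => sq_nonneg _
  have hcard : (1 : ℝ) ≤ S.card := by exact_mod_cast hS.card_pos
  -- By the sup bound, each end strip of width `h` carries at most a quarter of `β`, so the middle
  -- carries at least half. There `1 - x² ≥ h`, so `(2 S.card)^α` times the weight is at least 1.
  set h : ℝ := 1 / (2 * S.card) with hh
  have hh0 : 0 < h := by positivity
  have hh1 : h ≤ 1 / 2 := by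
    rw [hh]; exact one_div_le_one_div_of_le (by norm_num) (by linarith)
  have hgi : ∀ a b : ℝ, IntervalIntegrable (fun x => ‖g x‖ ^ 2) volume a b := fun a b =>
    (hg.norm.pow 2).intervalIntegrable a b
  have htot : ∫ x in (-1 : ℝ)..1, ‖g x‖ ^ 2 = β := by
    rw [intervalIntegral.integral_of_le (by norm_num), ← integral_Icc_eq_integral_Ioc,
      integral_norm_trigPoly_sq]
  have hsplit : ∫ x in (-1 : ℝ)..1, ‖g x‖ ^ 2 = (∫ x in (-1 : ℝ)..(-1 + h), ‖g x‖ ^ 2) +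
      (∫ x in (-1 + h)..(1 - h), ‖g x‖ ^ 2) + ∫ x in (1 - h)..1, ‖g x‖ ^ 2 := by
    rw [intervalIntegral.integral_add_adjacent_intervals (hgi _ _) (hgi _ _),
      intervalIntegral.integral_add_adjacent_intervals (hgi _ _) (hgi _ _)]
  have hedge : ∀ a : ℝ, ∫ x in a..(a + h), ‖g x‖ ^ 2 ≤ β / 4 := by
    intro a
    have h1 := intervalIntegral.integral_mono_on (μ := volume) (by linarith : a ≤ a + h)
      (hgi a (a + h)) intervalIntegrable_const (fun x _ => norm_trigPoly_sq_le S b x)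
    rw [intervalIntegral.integral_const, smul_eq_mul] at h1
    refine h1.trans (le_of_eq ?_)
    rw [← hβ, hh, add_sub_cancel_left]
    field_simp
    ring
  have hmid : ∫ x in (-1 + h)..(1 - h), ‖g x‖ ^ 2 ≤ (2 * S.card : ℝ) ^ α * wNorm α g ^ 2 := by
    rw [wNorm_sq (memLp_of_continuous hα hg), integral_jacobi,
      intervalIntegral.integral_of_le (by linarith), ← integral_const_mul]
    have hwc : Continuous fun x : ℝ => (1 - x ^ 2) ^ α :=
      Continuous.rpow_const (by fun_prop) fun x => Or.inr hα.le
    have hint : IntegrableOn (fun x : ℝ => (2 * S.card : ℝ) ^ α * ((1 - x ^ 2) ^ α • ‖g x‖ ^ 2))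
        (Set.Icc (-1) 1) :=
      (continuous_const.mul (hwc.smul (hg.norm.pow 2))).continuousOn.integrableOn_compact
        isCompact_Icc
    have hsub : Set.Ioc (-1 + h) (1 - h) ⊆ Set.Icc (-1) 1 := fun x hx =>
      ⟨by linarith [hx.1], by linarith [hx.2]⟩
    refine le_trans ?_ (setIntegral_mono_set hint ?_ hsub.eventuallyLE)
    · refine setIntegral_mono_on ((hgi _ _).1) (hint.mono_set hsub) measurableSet_Ioc fun x hx => ?_
      rw [smul_eq_mul, ← mul_assoc, ← Real.mul_rpow (by positivity)
        (by nlinarith [hx.1, hx.2])]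
      refine le_mul_of_one_le_left (sq_nonneg _) (Real.one_le_rpow ?_ hα.le)
      have h1 : h ≤ 1 - x ^ 2 := by nlinarith [hx.1, hx.2]
      have h2 : 2 * (S.card : ℝ) * h = 1 := by rw [hh]; field_simp
      calc (1 : ℝ) = 2 * S.card * h := h2.symm
        _ ≤ _ := by gcongr
    · filter_upwards [ae_restrict_mem measurableSet_Icc] with x hx
      have : 0 ≤ (1 - x ^ 2) ^ α := Real.rpow_nonneg (by nlinarith [hx.1, hx.2]) _
      simp only [Pi.zero_apply, smul_eq_mul]
      positivity
  have he1 := hedge (-1)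
  have he2 := hedge (1 - h)
  rw [sub_add_cancel] at he2
  linarith

/-! ### Splitting at frequency `N / 2` and the two estimates -/

/-- The frequencies `k` with `|k| π ≤ N / 2`. -/
noncomputable def lowFreq (N : ℕ) : Finset ℤ :=
  (Finset.Icc (-(N : ℤ)) N).filter fun k => |(k : ℝ) * Real.pi| ≤ N / 2

theorem mem_lowFreq {N : ℕ} {k : ℤ} : k ∈ lowFreq N ↔ |(k : ℝ) * Real.pi| ≤ N / 2 := by
  rw [lowFreq, Finset.mem_filter, and_iff_right_iff_imp]
  intro h
  rw [abs_mul, abs_of_pos Real.pi_pos] at h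
  have hN : (0 : ℝ) ≤ N := by positivity
  have h1 : |(k : ℝ)| ≤ N := by nlinarith [Real.pi_gt_three, abs_nonneg (k : ℝ)]
  rw [abs_le] at h1
  rw [Finset.mem_Icc]
  exact ⟨by exact_mod_cast h1.1, by exact_mod_cast h1.2⟩

theorem lowFreq_nonempty (N : ℕ) : (lowFreq N).Nonempty :=
  ⟨0, mem_lowFreq.2 (by simp; positivity)⟩

theorem card_lowFreq_le (N : ℕ) : ((lowFreq N).card : ℝ) ≤ 2 * N + 1 := by
  have h : (lowFreq N).card ≤ 2 * N + 1 := by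
    refine (Finset.card_filter_le _ _).trans ?_
    rw [Int.card_Icc]; omega
  exact_mod_cast h

/-- This is `log (t y) ≤ t y - 1` multiplied by `q`; `t` is free, so a power of `N` can be absorbed
at any exponential rate. -/
theorem rpow_le_mul_exp {q t y : ℝ} (hq : 0 ≤ q) (ht : 0 < t) (hy : 0 < y) :
    y ^ q ≤ t ^ (-q) * Real.exp (q * t * y) := by
  rw [Real.rpow_def_of_pos hy, Real.rpow_def_of_pos ht, ← Real.exp_add, Real.exp_le_exp]
  have h := Real.log_le_sub_one_of_pos (mul_pos ht hy)
  rw [Real.log_mul ht.ne' hy.ne'] at h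
  nlinarith

theorem wNorm_sq_le_integral {α : ℝ} (hα : 0 < α) {f : ℝ → ℂ}
    (hf : MemLp f 2 (volume.restrict (Set.Icc (-1) 1))) :
    wNorm α f ^ 2 ≤ ∫ x in Set.Icc (-1 : ℝ) 1, ‖f x‖ ^ 2 := by
  rw [wNorm_sq (hf.mono_measure (jacobiMeasure_le α hα))]
  exact integral_mono_measure (jacobiMeasure_le α hα) (ae_of_all _ fun x => sq_nonneg _)
    (hf.integrable_norm_pow two_ne_zero)

/-- The high frequency part of `f`. -/
theorem wNorm_sub_trigPoly_le {α : ℝ} (hα : 0 < α) {s : ℝ} (hs : 0 < s) {f : ℝ → ℂ}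
    (hf : MemHper s f) (N : ℕ) :
    wNorm α (fun x => f x - trigPoly (lowFreq N) (fourierB f) x) ≤
      (1 + ((N : ℝ) / 2) ^ 2) ^ (-s / 2) * hperNorm s f := by
  have hg := memLp_Icc_of_continuous (continuous_trigPoly (lowFreq N) (fourierB f))
  set A : ℝ := 1 + ((N : ℝ) / 2) ^ 2
  have hA : 0 < A := by positivity
  refine (sq_le_sq₀ (wNorm_nonneg _ _) (by unfold hperNorm; positivity)).1 ?_
  refine (wNorm_sq_le_integral hα (hf.1.sub hg)).trans ?_
  have h1 := hasSum_norm_fourierB_sq (hf.1.sub hg)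
  have h2 := hf.2.hasSum.mul_left (A ^ (-s))
  have h3 : (A ^ (-s / 2) * hperNorm s f) ^ 2 =
      A ^ (-s) * ∑' k : ℤ, (1 + (k * Real.pi) ^ 2) ^ s * ‖fourierB f k‖ ^ 2 := by
    rw [mul_pow, hperNorm, Real.sq_sqrt (tsum_nonneg fun k => by positivity), ← Real.rpow_natCast,
      ← Real.rpow_mul hA.le]
    congr 2
    push_cast; ring
  rw [h3]
  refine hasSum_le (fun k => ?_) h1 h2
  have h4 : fourierB (f - trigPoly (lowFreq N) (fourierB f)) k =
      fourierB f k - fourierB (trigPoly (lowFreq N) (fourierB f)) k := fourierB_sub hf.1 hg k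
  rw [h4, fourierB_trigPoly]
  by_cases hk : k ∈ lowFreq N
  · rw [if_pos hk, sub_self, norm_zero, zero_pow two_ne_zero]
    exact mul_nonneg (by positivity) (by positivity)
  · rw [if_neg hk, sub_zero, ← mul_assoc]
    refine le_mul_of_one_le_left (sq_nonneg _) ?_
    rw [mem_lowFreq, not_le] at hk
    have h5 : A ≤ 1 + (k * Real.pi) ^ 2 := by
      have := pow_le_pow_left₀ (by positivity) hk.le 2
      rw [sq_abs] at this
      simp only [A]; linarith
    -- Discarded modes satisfy `|k|π > N/2`, so their Sobolev weight is at least `A ^ s`.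
    calc (1 : ℝ) = A ^ (-s) * A ^ s := by rw [← Real.rpow_add hA]; simp
      _ ≤ _ := by gcongr

/-- The rate constant in the approximation of low frequency trigonometric polynomials. -/
noncomputable def lowConst (α c : ℝ) : ℝ :=
  3 * (chebConst α c + 4) * ((1 / (40 * (α + 1))) ^ (-((α + 1) / 2)) * Real.exp (1 / 40))

/-- The low frequency part of `f`. -/
theorem IsGPSWF.wNorm_trigPoly_sub_partialSum_le {α c : ℝ} {μ : ℕ → ℂ} {ψ : ℕ → ℝ → ℂ}
    (hα : 0 < α) (hc : 1 ≤ c) (h : IsGPSWF α c μ ψ) (N : ℕ) (b : ℤ → ℂ) :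
    wNorm α (fun t => trigPoly (lowFreq N) b t -
        partialSum α ψ N (trigPoly (lowFreq N) b) t) ≤
      lowConst α c * Real.exp (-(1 / 20) * N) * wNorm α (trigPoly (lowFreq N) b) := by
  set S := lowFreq N
  set g := trigPoly S b with hg
  have hC := chebConst_nonneg α c
  have hgm : MemLp g 2 (jacobiMeasure α) := memLp_of_continuous hα (continuous_trigPoly S b)
  have hcard : (1 : ℝ) ≤ S.card := by exact_mod_cast (lowFreq_nonempty N).card_pos
  set B := ∑ k ∈ S, ‖b k‖ with hB
  have hB0 : 0 ≤ B := Finset.sum_nonneg fun k _ => norm_nonneg _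
  have hdecay : ∀ n, N ≤ n → ‖wInner α g (ψ n)‖ ≤
      ((chebConst α c + 4) * B) * Real.exp (-(1 / 10) * n) := by
    intro n hn
    have h1 : wInner α g (ψ n) = ∑ k ∈ S, b k / Real.sqrt 2 *
        wInner α (fun x => Complex.exp (Complex.I * (k * Real.pi : ℝ) * x)) (ψ n) :=
      wInner_sum_left S (fun k => b k / Real.sqrt 2)
        (fun k => memLp_of_continuous hα (by fun_prop)) (h.memLp n)
    rw [h1, hB, mul_comm (chebConst α c + 4), mul_assoc, Finset.sum_mul]
    refine (norm_sum_le _ _).trans (Finset.sum_le_sum fun k hk => ?_)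
    rw [norm_mul]
    have h2 : ‖b k / (Real.sqrt 2 : ℂ)‖ ≤ ‖b k‖ := by
      rw [norm_div, Complex.norm_real, Real.norm_of_nonneg (Real.sqrt_nonneg _)]
      exact div_le_self (norm_nonneg _) (Real.one_le_sqrt.2 (by norm_num))
    refine mul_le_mul h2 (h.norm_wInner_exp_le hα hc n _ ((mem_lowFreq.1 hk).trans ?_))
      (norm_nonneg _) (norm_nonneg _)
    have : (N : ℝ) ≤ n := by exact_mod_cast hn
    linarith
  have h3 := h.wNorm_sub_partialSum_le_exp hα (by linarith) N hgm
    (mul_nonneg (by linarith) hB0) hdecay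
  refine h3.trans ?_
  set q := (α + 1) / 2 with hq
  -- Cauchy–Schwarz costs one factor `S.card` and removing the weight costs `(2 S.card)^α`; together
  -- they give the exponent `α + 1`, halved by the square root.
  have hBle : B ≤ (2 * S.card : ℝ) ^ q * wNorm α g := by
    have hw := wNorm_nonneg α g
    refine (sq_le_sq₀ hB0 (by positivity)).1 ?_
    have h4 := sum_sq_le_wNorm_trigPoly hα (lowFreq_nonempty N) b
    calc B ^ 2 ≤ S.card * ∑ k ∈ S, ‖b k‖ ^ 2 := sq_sum_le_card_mul_sum_sq
      _ ≤ S.card * (2 * (2 * S.card : ℝ) ^ α * wNorm α g ^ 2) := by gcongr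
      _ = ((2 * S.card : ℝ) ^ α * (2 * S.card : ℝ)) * wNorm α g ^ 2 := by ring
      _ = _ := by
        rw [mul_pow, ← Real.rpow_natCast (_ ^ q), ← Real.rpow_mul (by positivity),
          ← Real.rpow_add_one (by positivity)]
        congr 2
        rw [hq]; push_cast; ring
  -- With `t = 1 / (40 (α + 1))`, `q t (4N + 2) = N/20 + 1/40`, so half of the rate `1/10` survives.
  have hrp : (2 * S.card : ℝ) ^ q ≤
      (1 / (40 * (α + 1))) ^ (-q) * Real.exp (1 / 40) * Real.exp (1 / 20 * N) := by
    have h5 : (2 * S.card : ℝ) ≤ 4 * N + 2 := by linarith [card_lowFreq_le N]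
    calc (2 * S.card : ℝ) ^ q ≤ (4 * N + 2 : ℝ) ^ q :=
          Real.rpow_le_rpow (by positivity) h5 (by positivity)
      _ ≤ (1 / (40 * (α + 1))) ^ (-q) * Real.exp (q * (1 / (40 * (α + 1))) * (4 * N + 2)) :=
          rpow_le_mul_exp (by positivity) (by positivity) (by positivity)
      _ = _ := by
        rw [mul_assoc (_ ^ (-q)) (Real.exp _), ← Real.exp_add]
        congr 2
        rw [hq]; field_simp; ring
  have hexp : Real.exp (-(1 / 20) * N) = Real.exp (1 / 20 * N) * Real.exp (-(1 / 10) * N) := by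
    rw [← Real.exp_add]; congr 1; ring
  rw [lowConst, hexp]
  have hw := wNorm_nonneg α g
  calc _ ≤ 3 * ((chebConst α c + 4) * (((1 / (40 * (α + 1))) ^ (-q) * Real.exp (1 / 40) *
        Real.exp (1 / 20 * N)) * wNorm α g)) * Real.exp (-(1 / 10) * N) := by
        have := hBle.trans (mul_le_mul_of_nonneg_right hrp hw)
        gcongr
    _ = _ := by ring

/-- The partial sums of the expansion of `f ∈ H^s_per` in the wave functions converge to `f`. -/
theorem exists_wNorm_sub_partialSum_le {c α : ℝ} (hc : 1 < c) (hα : 0 < α) :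
    ∃ K : ℝ, 0 < K ∧ ∃ a : ℝ, 0 < a ∧
      ∀ (μ : ℕ → ℂ) (ψ : ℕ → ℝ → ℂ), IsGPSWF α c μ ψ →
        ∀ (N : ℕ) (s : ℝ) (f : ℝ → ℂ), 0 < s → MemHper s f →
          wNorm α (fun t => f t - partialSum α ψ N f t) ≤
            (1 + ((N : ℝ) / 2) ^ 2) ^ (-s / 2) * hperNorm s f
              + K * Real.exp (-a * N) * wNorm α f := by
  have hK : 0 < lowConst α c := by
    have := chebConst_nonneg α c
    unfold lowConst; positivity
  refine ⟨2 * lowConst α c, by positivity, 1 / 20, by norm_num, ?_⟩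
  intro μ ψ h N s f hs hf
  have hc0 : 0 ≤ c := by linarith
  set g := trigPoly (lowFreq N) (fourierB f)
  set u : ℝ → ℂ := fun x => f x - g x
  have hfm : MemLp f 2 (jacobiMeasure α) := hf.1.mono_measure (jacobiMeasure_le α hα)
  have hgm : MemLp g 2 (jacobiMeasure α) := memLp_of_continuous hα (continuous_trigPoly _ _)
  have hum : MemLp u 2 (jacobiMeasure α) := hfm.sub hgm
  have hhigh := wNorm_sub_trigPoly_le hα hs hf N
  change wNorm α u ≤ _ at hhigh
  have hrest : 0 ≤ 2 * lowConst α c * Real.exp (-(1 / 20) * N) * wNorm α f :=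
    mul_nonneg (by positivity) (wNorm_nonneg _ _)
  -- If `u` is at least as large as `f`, contractivity on `f` and the bound for `u` suffice.
  -- Otherwise `‖g‖ ≤ 2 ‖f‖`, the source of the 2 in `K`.
  rcases le_total (wNorm α f) (wNorm α u) with hfu | huf
  · have := h.wNorm_sub_partialSum_le hα hc0 N hfm
    linarith
  have hgf : wNorm α g ≤ 2 * wNorm α f := by
    have h1 := wNorm_sub_le hfm hum
    have h2 : (fun x => f x - u x) = g := by ext x; simp [u]
    rw [h2] at h1
    linarith
  have hsplit : (fun t => f t - partialSum α ψ N f t) =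
      fun t => (u t - partialSum α ψ N u t) + (g t - partialSum α ψ N g t) := by
    ext t
    have h1 : partialSum α ψ N u t = partialSum α ψ N f t - partialSum α ψ N g t := by
      simp only [partialSum]
      rw [← Finset.sum_sub_distrib]
      refine Finset.sum_congr rfl fun n _ => ?_
      rw [← sub_mul, ← wInner_sub_left hfm hgm (h.memLp n)]
    rw [h1]
    simp only [u]
    ring
  rw [hsplit]
  have h0 := wNorm_add_le (hum.sub (h.memLp_partialSum N u)) (hgm.sub (h.memLp_partialSum N g))
  refine h0.trans ?_
  change wNorm α (fun t => u t - partialSum α ψ N u t) +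
    wNorm α (fun t => g t - partialSum α ψ N g t) ≤ _
  have h1 := h.wNorm_sub_partialSum_le hα hc0 N hum
  have h2 : wNorm α (fun t => g t - partialSum α ψ N g t) ≤
      lowConst α c * Real.exp (-(1 / 20) * N) * wNorm α g :=
    h.wNorm_trigPoly_sub_partialSum_le hα hc.le N (fourierB f)
  have h3 : lowConst α c * Real.exp (-(1 / 20) * N) * wNorm α g ≤
      lowConst α c * Real.exp (-(1 / 20) * N) * (2 * wNorm α f) := by gcongr
  linarith

theorem exists_norm_wInner_exp_le {c α : ℝ} (hc : 1 ≤ c) (hα : 0 < α) :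
    ∃ C : ℝ, 0 < C ∧
      ∀ (μ : ℕ → ℂ) (ψ : ℕ → ℝ → ℂ), IsGPSWF α c μ ψ →
        ∀ (n : ℕ) (k : ℝ), 0 < k → k ≤ 0.14 * (n : ℝ) →
          ‖wInner α (fun x => Complex.exp (Complex.I * k * Real.pi * x)) (ψ n)‖ ≤
            C * Real.exp (-(1 / 10) * n) := by
  have hC := chebConst_nonneg α c
  refine ⟨chebConst α c + 4, by linarith, fun μ ψ h n k hk hkn => ?_⟩
  -- `0.14 · π < 1/2` puts the frequency `kπ` within the range `n / 2`.
  have h1 := h.norm_wInner_exp_le hα hc n (k * Real.pi) (by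
    rw [abs_of_nonneg (by positivity)]
    have hn : (0 : ℝ) ≤ n := by positivity
    calc k * Real.pi ≤ 0.14 * n * 3.15 := by
          gcongr
          exact Real.pi_lt_d2.le
      _ ≤ n / 2 := by linarith)
  have h2 : (fun x : ℝ => Complex.exp (Complex.I * k * Real.pi * x)) =
      fun x : ℝ => Complex.exp (Complex.I * (k * Real.pi : ℝ) * x) := by
    ext x; push_cast; ring_nf
  rw [h2]
  exact h1

end GPSWF

theorem mainTheorem7 :
    (∀ c α : ℝ, 1 < c → 0 < α →
      ∃ K : ℝ, 0 < K ∧ ∃ a : ℝ, 0 < a ∧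
        ∀ (μ : ℕ → ℂ) (ψ : ℕ → ℝ → ℂ), GPSWF.IsGPSWF α c μ ψ →
          ∀ (N : ℕ) (s : ℝ) (f : ℝ → ℂ), GPSWF.mConst α * c < (N : ℝ) → 0 < s →
            GPSWF.MemHper s f →
            GPSWF.wNorm α (fun t => f t - GPSWF.partialSum α ψ N f t) ≤
              (1 + ((N : ℝ) / 2) ^ 2) ^ (-s / 2) * GPSWF.hperNorm s f
                + K * Real.exp (-a * N) * GPSWF.wNorm α f) ∧
    (∃ δ : ℝ, 0 < δ ∧ ∀ c α : ℝ, 1 ≤ c → 0 < α →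
      ∃ C : ℝ, 0 < C ∧
        ∀ (μ : ℕ → ℂ) (ψ : ℕ → ℝ → ℂ), GPSWF.IsGPSWF α c μ ψ →
          ∀ (n : ℕ) (k : ℝ), 0 < k → k ≤ 0.14 * (n : ℝ) → GPSWF.mConst α * c ≤ (n : ℝ) →
            ‖GPSWF.wInner α (fun x => Complex.exp (Complex.I * k * Real.pi * x)) (ψ n)‖ ≤
              C * Real.exp (-δ * n)) := by
  refine ⟨fun c α hc hα => ?_, 1 / 10, by norm_num, fun c α hc hα => ?_⟩
  · obtain ⟨K, hK, a, ha, h⟩ := GPSWF.exists_wNorm_sub_partialSum_le hc hα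
    exact ⟨K, hK, a, ha, fun μ ψ hψ N s f _ hs hf => h μ ψ hψ N s f hs hf⟩
  · obtain ⟨C, hC, h⟩ := GPSWF.exists_norm_wInner_exp_le hc hα
    exact ⟨C, hC, fun μ ψ hψ n k hk hkn _ => h μ ψ hψ n k hk hkn⟩
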